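/- Let $\mu:\mathbb{C}^2\to\mathbb{R}^2$, $\mu(z_1,z_2)=(\pi|z_1|^2,\pi|z_2|^2)$. Let $\Omega\subset\mathbb{R}^2_{\ge 0}$ be a bounded closed region containing the origin whose boundary relative to $\mathbb{R}^2_{\ge0}$ is the image of a smooth embedded curve $f:[0,1]\to\mathbb{R}^2$ with $f(0)=(0,a)$, $f(1)=(b,0)$, $a,b>0$, and $f(s)$ in the open quadrant for $0<s<1$. Put $X_\Omega=\mu^{-1}(\Omega)$ and $M_f=\mu^{-1}(f([0,1]))$. The standard Hamiltonian flow on $M_f\subset\mathbb{C}^2=\mathbb{R}^4$ is the flow of $X=J\nu$, where $\nu$ is the outer unit normal of $X_\Omega$ along $M_f$ and $J$ is multiplication by $i$. The hypersurface $M_f$ is star-shaped if every ray from the origin meets it exactly once and the position vector is nowhere tangent to it. A Birkhoff section for the flow of $X$ on $M_f$ is a smooth immersion $\iota:S\to M_f$ of a compact surface $S$ (possibly with boundary) such that (1) $\iota(\partial S)$ consists of periodic orbits of $X$; (2) $\iota^{-1}(\iota(\partial S))=\partial S$, and $\iota$ restricted to $S\setminus\partial S$ is an embedding transverse to $X$;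 (3) for every $p\in M_f$ the flow line through $p$ meets $\iota(S)$ at some negative and at some positive time. The periodic orbits making up $\iota(\partial S)$ are its boundary orbits. **Theorem.** For every integer $k>0$ there are $\Omega$ and $f$ as above such that - $M_f$ is star-shaped; - the standard Hamiltonian flow on $M_f$ is equivalent to a Reeb flow on the tight $S^3$: there are a smooth contact form $\alpha$ on $S^3$ whose kernel is the tight contact structure $TS^3\cap J\,TS^3$ and a diffeomorphism $S^3\to M_f$ that takes the Reeb vector field of $\alpha$ to a positive multiple of $X$; - $f((0,1))$ contains $k$ pairwise disjoint semicircles, each of the form $\{x: |x-c|=\rho,\ \langle x-c,c\rangle\ge 0\}$ with $c\neq0$ and $\rho>0$ (so that its diameter is the base of an isosceles triangle with apex at the origin), and on each of them the direction of the linear flow on the tori $\mu^{-1}(x)$ sweeps all of $\mathbb{RP}^1$ as $x$ runs over the semicircle; - every Birkhoff section for the flow on $M_f$ has at least $k$ distinct boundary orbits. -/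

import Mathlib

open scoped Manifold ContDiff Topology

namespace ToricBirkhoff

/-- `ℂ² = ℝ⁴`, with its Euclidean norm and its real inner product `⟪z, w⟫ = Re ∑ⱼ conj zⱼ * wⱼ`. -/
abbrev C2 : Type := EuclideanSpace ℂ (Fin 2)

/-- The Euclidean plane. -/
abbrev Plane : Type := EuclideanSpace ℝ (Fin 2)

/-! ### Toric domains and their boundaries -/

/-- The moment map `(z₁, z₂) ↦ (π |z₁|², π |z₂|²)`. -/
noncomputable def moment (z : C2) : Plane := !₂[Real.pi * ‖z 0‖ ^ 2, Real.pi * ‖z 1‖ ^ 2]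

/-- The closed first quadrant. -/
def quadrant : Set Plane := {x | 0 ≤ x 0 ∧ 0 ≤ x 1}

/-- The toric domain `X_Ω = μ⁻¹(Ω)`. -/
def toricDomain (Ω : Set Plane) : Set C2 := moment ⁻¹' Ω

/-- The boundary `M_f = μ⁻¹(f([0,1]))`. -/
def toricBoundary (f : ℝ → Plane) : Set C2 := moment ⁻¹' (f '' Set.Icc 0 1)

/-- `Ω` is a bounded closed region of the quadrant containing the origin, and it is bounded by
the smooth embedded curve `f : [0,1] → ℝ²`, which runs from the vertical to the
horizontal axis through the open quadrant. Since `Ω` is closed, `Ω ∩ closure (quadrant \ Ω)` is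
its boundary relative to the quadrant. -/
structure IsBoundedByCurve (Ω : Set Plane) (f : ℝ → Plane) : Prop where
  isClosed : IsClosed Ω
  isBounded : Bornology.IsBounded Ω
  subset_quadrant : Ω ⊆ quadrant
  zero_mem : (0 : Plane) ∈ Ω
  smooth : ContDiffOn ℝ ∞ f (Set.Icc 0 1)
  injOn : Set.InjOn f (Set.Icc 0 1)
  deriv_ne_zero : ∀ s ∈ Set.Icc (0 : ℝ) 1, derivWithin f (Set.Icc 0 1) s ≠ 0
  start : f 0 0 = 0 ∧ 0 < f 0 1
  finish : 0 < f 1 0 ∧ f 1 1 = 0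
  inside : ∀ s ∈ Set.Ioo (0 : ℝ) 1, 0 < f s 0 ∧ 0 < f s 1
  boundary_eq : Ω ∩ closure (quadrant \ Ω) = f '' Set.Icc 0 1

/-- A hypersurface of `ℝ⁴` is star-shaped (about the origin) if every ray from the
origin meets it exactly once, and does so transversally: the position vector is not tangent.
For a smooth hypersurface the tangent cone is the tangent space. -/
def IsStarShaped (M : Set C2) : Prop :=
  (∀ u : C2, u ≠ 0 → ∃! r : ℝ, 0 < r ∧ r • u ∈ M) ∧ ∀ z ∈ M, z ∉ tangentConeAt ℝ M z

/-! ### The standard Hamiltonian flow -/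

/-- `ν` is the outer unit normal at `z` of the domain `W` with smooth boundary `M`. -/
def IsOuterUnitNormal (W M : Set C2) (z ν : C2) : Prop :=
  ‖ν‖ = 1 ∧ (∀ v ∈ tangentConeAt ℝ M z, inner ℝ ν v = 0) ∧
    ∀ᶠ t : ℝ in 𝓝[>] 0, z + t • ν ∉ W

/-- `X` is the standard Hamiltonian vector field `J ν` along `M`, the boundary of `W`. Only the
values of `X` on `M` matter. -/
def IsStandardField (W M : Set C2) (X : C2 → C2) : Prop :=
  ∀ z ∈ M, ∃ ν, IsOuterUnitNormal W M z ν ∧ X z = Complex.I • ν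

/-- `φ` is the flow on `M` of the vector field `X` tangent to `M`. -/
structure IsFlowOn (M : Set C2) (X : C2 → C2) (φ : ℝ → C2 → C2) : Prop where
  zero : ∀ p ∈ M, φ 0 p = p
  mem : ∀ p ∈ M, ∀ t, φ t p ∈ M
  hasDerivAt : ∀ p ∈ M, ∀ t, HasDerivAt (fun τ => φ τ p) (X (φ t p)) t

/-- The orbit of `p`. -/
def orbit (φ : ℝ → C2 → C2) (p : C2) : Set C2 := Set.range fun t => φ t p

/-! ### Birkhoff sections -/

/-- A Birkhoff section for the flow `φ` of `X` on the smooth hypersurface `M`: a smooth immersion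
`ι` of a compact surface `S` with (possibly empty) boundary into `M` such that
`ι(∂S)` consists of periodic orbits, `ι⁻¹(ι(∂S)) = ∂S`, `ι` restricts to an embedding of `S \ ∂S`
transverse to `X`, and every flow line meets `ι(S)` in the future and in the past. A smooth
immersion into `M` is the same as one into `ℝ⁴` with values in `M`. -/
structure IsBirkhoffSection (M : Set C2) (X : C2 → C2) (φ : ℝ → C2 → C2)
    {S : Type*} [TopologicalSpace S] [T2Space S] [CompactSpace S]
    [ChartedSpace (EuclideanHalfSpace 2) S] [IsManifold (𝓡∂ 2) ∞ S] (ι : S → C2) : Prop where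
  mem : ∀ x, ι x ∈ M
  smooth : ContMDiff (𝓡∂ 2) 𝓘(ℝ, C2) ∞ ι
  immersion : ∀ x, Function.Injective (mfderiv (𝓡∂ 2) 𝓘(ℝ, C2) ι x)
  boundary_periodic : ∀ x ∈ (𝓡∂ 2).boundary S,
    (∃ T : ℝ, 0 < T ∧ φ T (ι x) = ι x) ∧ orbit φ (ι x) ⊆ ι '' (𝓡∂ 2).boundary S
  preimage_boundary : ι ⁻¹' (ι '' (𝓡∂ 2).boundary S) = (𝓡∂ 2).boundary S
  embedding : Topology.IsEmbedding fun x : {x : S // x ∉ (𝓡∂ 2).boundary S} => ι x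
  transverse : ∀ x ∉ (𝓡∂ 2).boundary S,
    ∀ v : TangentSpace (𝓡∂ 2) x, mfderiv (𝓡∂ 2) 𝓘(ℝ, C2) ι x v ≠ X (ι x)
  returns : ∀ p ∈ M, (∃ t, t < 0 ∧ φ t p ∈ Set.range ι) ∧ ∃ t, 0 < t ∧ φ t p ∈ Set.range ι

/-- The set of boundary orbits of a surface `ι : S → M`. -/
def boundaryOrbits (φ : ℝ → C2 → C2) {S : Type*} [TopologicalSpace S]
    [ChartedSpace (EuclideanHalfSpace 2) S] (ι : S → C2) : Set (Set C2) :=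
  (fun x => orbit φ (ι x)) '' (𝓡∂ 2).boundary S

/-! ### Reeb flows on the tight three-sphere -/

/-- The unit sphere `S³` in `ℂ²`. -/
def S3 : Set C2 := Metric.sphere 0 1

/-- The tangent space of `S³` at `p`. -/
def tangentS3 (p : C2) : Set C2 := {v | inner ℝ p v = 0}

/-- The tight contact structure of `S³`: the complex tangencies `TS³ ∩ J TS³`. -/
def tightPlane (p : C2) : Set C2 := {v | v ∈ tangentS3 p ∧ Complex.I • v ∈ tangentS3 p}

/-- The exterior derivative of a one-form. -/
noncomputable def dForm (α : C2 → C2 →L[ℝ] ℝ) (p u v : C2) : ℝ :=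
  fderiv ℝ α p u v - fderiv ℝ α p v u

/-- The restriction of `α` to `S³` is a smooth contact form defining the tight contact structure.
Every smooth one-form on `S³` is the restriction of one that is smooth near `S³`, and
restriction commutes with the exterior derivative. -/
structure IsTightContactForm (α : C2 → C2 →L[ℝ] ℝ) : Prop where
  smooth : ∃ U, IsOpen U ∧ S3 ⊆ U ∧ ContDiffOn ℝ ∞ α U
  kernel : ∀ p ∈ S3, ∀ v ∈ tangentS3 p, α p v = 0 ↔ v ∈ tightPlane p
  contact : ∀ p ∈ S3, ∀ v ∈ tightPlane p, v ≠ 0 → ∃ w ∈ tightPlane p, dForm α p v w ≠ 0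

/-- `R` is the Reeb vector field on `S³` of the contact form `α`. -/
def IsReebField (α : C2 → C2 →L[ℝ] ℝ) (R : C2 → C2) : Prop :=
  ∀ p ∈ S3, R p ∈ tangentS3 p ∧ α p (R p) = 1 ∧ ∀ v ∈ tangentS3 p, dForm α p (R p) v = 0

/-- `Φ` restricts to a diffeomorphism from `S³` onto the hypersurface `M`; as `S³` is
compact, this is an injective smooth immersion with image `M`. -/
structure IsDiffeoFromS3 (M : Set C2) (Φ : C2 → C2) : Prop where
  smooth : ∃ U, IsOpen U ∧ S3 ⊆ U ∧ ContDiffOn ℝ ∞ Φ U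
  injOn : Set.InjOn Φ S3
  image : Φ '' S3 = M
  immersion : ∀ p ∈ S3, ∀ v ∈ tangentS3 p, fderiv ℝ Φ p v = 0 → v = 0

/-- The flow of `X` on `M` is equivalent to a Reeb flow on the tight `S³`: a diffeomorphism
`S³ → M` takes the Reeb field to a positive multiple of `X`, hence Reeb orbits to orbits of `X`
with their orientations. -/
def IsEquivalentToTightReebFlow (M : Set C2) (X : C2 → C2) : Prop :=
  ∃ (α : C2 → C2 →L[ℝ] ℝ) (R Φ : C2 → C2), IsTightContactForm α ∧ IsReebField α R ∧
    IsDiffeoFromS3 M Φ ∧ ∀ p ∈ S3, ∃ c : ℝ, 0 < c ∧ fderiv ℝ Φ p (R p) = c • X (Φ p)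

/-! ### Semicircles -/

/-- The semicircle of radius `ρ` about `c` on the far side from the origin, whose diameter is
perpendicular to the segment from the origin to `c`. Its diameter is thus the base of an
isosceles triangle with apex at the origin. -/
def outerSemicircle (c : Plane) (ρ : ℝ) : Set Plane := {x | dist x c = ρ ∧ 0 ≤ inner ℝ (x - c) c}

/-- The directions of the linear flow of `X` on the tori `μ⁻¹(x)`, `x ∈ A`, sweep all of `ℝP¹`: for
each `w ≠ 0` there is a torus on which `X` is a constant nonzero multiple of the
infinitesimal rotation `(i w₁ z₁, i w₂ z₂)`. -/
def SweepsAllDirections (X : C2 → C2) (A : Set Plane) : Prop :=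
  ∀ w : Plane, w ≠ 0 → ∃ x ∈ A, ∃ c : ℝ, c ≠ 0 ∧ ∀ z : C2, moment z = x →
    X z = c • !₂[Complex.I * w 0 * z 0, Complex.I * w 1 * z 1]

end ToricBirkhoff

namespace ToricBirkhoff

/-! ### Circle-valued functions and their lifts -/

/-! The obstruction is cohomological and lives over one semicircle `A`. Suppose a Birkhoff section
has no boundary orbit over `A`. Then its trace on the compact set `μ⁻¹(A)`, a family of tori, is a
closed local section that every orbit meets again. Such a section is dual to a map to the circle
(`sectionMap`) that winds once at each crossing. The flow itself co-orients the surface, so every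
crossing counts positively, and along each orbit a real lift of this map is monotone and unbounded
(`IsLocalSection.lift_monotone`, `IsLocalSection.not_bddAbove_lift`).

On the other hand the periods `(m, n)` of a circle-valued map on a connected family of tori are the
same on all tori. The direction of the linear flow sweeps `ℝP¹` over `A`, so on some torus it is
annihilated by `(m, n)`; there the lift is bounded along orbits (`exists_bddAbove_lift`). This
contradiction is `not_exists_section_of_linear_flow`. The inverse function theorem supplies
continuous crossing times (`exists_crossing_time_of_isBirkhoffSection`). Hence each of `k` disjoint
semicircles carries a boundary orbit, and these orbits are distinct because the flow preserves the
moment map.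

For the example, the curve is a level set of a positive function, homogeneous of degree one, with
smooth profile `e` on the simplex. For any such `e` the hypersurface is star-shaped, and the
Liouville form divided by the gauge is a contact form on `S³` whose Reeb field goes to a multiple of
`X` under radial projection. An outer semicircle is a smooth radial graph up to and beyond its ends,
so a partition of unity gives one `e` whose level set contains all `k` of them (`exists_profile`).
The normals of a semicircle fill a half circle, that is, all of `ℝP¹` (`exists_arc_direction`). -/

theorem eq_of_int_mul_two_pi_valued {A : Type*} [TopologicalSpace A] {S : Set A}
    (hS : IsPreconnected S) {D : A → ℝ} (hD : ContinuousOn D S)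
    (hval : ∀ p ∈ S, ∃ m : ℤ, D p = m * (2 * Real.pi)) {p q : A} (hp : p ∈ S) (hq : q ∈ S) :
    D p = D q := by
  refine hS.constant_of_mapsTo (T := (AddSubgroup.zmultiples (2 * Real.pi) : Set ℝ))
    ⟨inferInstanceAs (DiscreteTopology (AddSubgroup.zmultiples (2 * Real.pi)))⟩ hD ?_ hp hq
  intro x hx
  obtain ⟨m, hm⟩ := hval x hx
  exact AddSubgroup.mem_zmultiples_iff.2 ⟨m, by simp [hm]⟩

theorem int_mul_two_pi_of_circleExp_eq {x y : ℝ} (h : Circle.exp x = Circle.exp y) :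
    ∃ m : ℤ, x - y = m * (2 * Real.pi) := by
  obtain ⟨m, hm⟩ := Circle.exp_eq_exp.1 h
  exact ⟨m, by rw [hm]; ring⟩

theorem eq_add_int_mul_of_periodic {D : ℝ × ℝ → ℝ} {T : ℝ}
    (h₁ : ∀ x y, D (x + T, y) = D (x, y)) (h₂ : ∀ x y, D (x, y + T) = D (x, y))
    (m n : ℤ) (x y : ℝ) : D (x - m * T, y - n * T) = D (x, y) := by
  have p₁ : Function.Periodic (fun x => D (x, y - n * T)) T := fun x => h₁ x _
  have p₂ : Function.Periodic (fun y => D (x, y)) T := fun y => h₂ x y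
  exact (p₁.sub_int_mul_eq m).trans (p₂.sub_int_mul_eq n)

theorem bddAbove_range_of_doubly_periodic {D : ℝ × ℝ → ℝ} (hD : Continuous D) {T : ℝ} (hT : 0 < T)
    (h₁ : ∀ x y, D (x + T, y) = D (x, y)) (h₂ : ∀ x y, D (x, y + T) = D (x, y)) :
    BddAbove (Set.range D) := by
  obtain ⟨B, hB⟩ := ((isCompact_Icc (a := (0 : ℝ)) (b := T)).prod
    (isCompact_Icc (a := (0 : ℝ)) (b := T))).bddAbove_image hD.continuousOn
  have aux : ∀ x : ℝ, x - ⌊x / T⌋ * T ∈ Set.Icc 0 T := by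
    intro x
    have h := (div_lt_iff₀ hT).1 (Int.lt_floor_add_one (x / T))
    exact ⟨sub_nonneg.2 ((le_div_iff₀ hT).1 (Int.floor_le _)), by linarith⟩
  refine ⟨B, ?_⟩
  rintro _ ⟨⟨x, y⟩, rfl⟩
  rw [← eq_add_int_mul_of_periodic h₁ h₂ ⌊x / T⌋ ⌊y / T⌋ x y]
  exact hB ⟨_, ⟨aux x, aux y⟩, rfl⟩

/-- A continuous circle-valued function on a family of tori has constant periods, so along any
linear flow that is annihilated by the periods its lifts are bounded. -/
theorem exists_bddAbove_lift {g : ℝ × ℝ × ℝ → Circle} (hg : Continuous g)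
    (h₁ : ∀ x y s, g (x + 2 * Real.pi, y, s) = g (x, y, s))
    (h₂ : ∀ x y s, g (x, y + 2 * Real.pi, s) = g (x, y, s)) {a b : ℝ → ℝ}
    (hab : ∀ m n : ℤ, ∃ s, m * a s + n * b s = 0) :
    ∃ (s : ℝ) (γ : ℝ → ℝ), Continuous γ ∧
      (∀ t, Circle.exp (γ t) = g (t * a s, t * b s, s)) ∧ BddAbove (Set.range γ) := by
  obtain ⟨e₀, he₀⟩ : ∃ e₀ : ℝ, Circle.exp e₀ = g (0, 0, 0) := Circle.exp_surjective _
  obtain ⟨G, ⟨-, hG⟩, -⟩ := Circle.isCoveringMap_exp.existsUnique_continuousMap_lifts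
    (⟨g, hg⟩ : C(ℝ × ℝ × ℝ, Circle)) (0, 0, 0) e₀ he₀
  replace hG : ∀ p, Circle.exp (G p) = g p := fun p => congrFun hG p
  have hGc := G.continuous
  -- The jump of the lift over a period is continuous with values in `2πℤ`, so one integer serves
  -- all tori.
  obtain ⟨m, hm⟩ : ∃ m : ℤ, ∀ x y s, G (x + 2 * Real.pi, y, s) - G (x, y, s)
      = m * (2 * Real.pi) := by
    have hv : ∀ p : ℝ × ℝ × ℝ, ∃ m : ℤ, G (p.1 + 2 * Real.pi, p.2.1, p.2.2) - G p
        = m * (2 * Real.pi) := fun p =>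
      int_mul_two_pi_of_circleExp_eq (by rw [hG, hG, h₁])
    obtain ⟨m, hm⟩ := hv (0, 0, 0)
    refine ⟨m, fun x y s => ?_⟩
    rw [← hm]
    exact eq_of_int_mul_two_pi_valued (p := (x, y, s)) (q := (0, 0, 0)) isPreconnected_univ
      (D := fun p : ℝ × ℝ × ℝ => G (p.1 + 2 * Real.pi, p.2.1, p.2.2) - G p)
      (by fun_prop) (fun p _ => hv p) trivial trivial
  obtain ⟨n, hn⟩ : ∃ n : ℤ, ∀ x y s, G (x, y + 2 * Real.pi, s) - G (x, y, s)
      = n * (2 * Real.pi) := by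
    have hv : ∀ p : ℝ × ℝ × ℝ, ∃ m : ℤ, G (p.1, p.2.1 + 2 * Real.pi, p.2.2) - G p
        = m * (2 * Real.pi) := fun p =>
      int_mul_two_pi_of_circleExp_eq (by rw [hG, hG, h₂])
    obtain ⟨n, hn⟩ := hv (0, 0, 0)
    refine ⟨n, fun x y s => ?_⟩
    rw [← hn]
    exact eq_of_int_mul_two_pi_valued (p := (x, y, s)) (q := (0, 0, 0)) isPreconnected_univ
      (D := fun p : ℝ × ℝ × ℝ => G (p.1, p.2.1 + 2 * Real.pi, p.2.2) - G p)
      (by fun_prop) (fun p _ => hv p) trivial trivial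
  obtain ⟨s, hs⟩ := hab m n
  refine ⟨s, fun t => G (t * a s, t * b s, s), by fun_prop, fun t => hG _, ?_⟩
  -- Subtracting the linear function with the same periods leaves a doubly periodic, hence bounded,
  -- function; along the chosen orbit the linear part vanishes.
  obtain ⟨B, hB⟩ := bddAbove_range_of_doubly_periodic
    (D := fun p : ℝ × ℝ => G (p.1, p.2, s) - m * p.1 - n * p.2) (by fun_prop) Real.two_pi_pos
    (fun x y => by linarith [hm x y s]) (fun x y => by linarith [hn x y s])
  refine ⟨B, ?_⟩
  rintro _ ⟨t, rfl⟩
  have := hB ⟨(t * a s, t * b s), rfl⟩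
  have h0 : t * (m * a s + n * b s) = 0 := by rw [hs, mul_zero]
  simp only at this ⊢
  linarith

/-! ### The circle-valued function dual to a section -/

/-- A ramp from `2π` at `-δ` to `0` at `δ`, constant outside `[-δ, δ]`. -/
noncomputable def ramp (δ t : ℝ) : ℝ := 2 * Real.pi * max 0 (min 1 ((1 - t / δ) / 2))

theorem continuous_ramp (δ : ℝ) : Continuous (ramp δ) := by unfold ramp; fun_prop

theorem ramp_antitone {δ : ℝ} (hδ : 0 < δ) : Antitone (ramp δ) := by
  intro x y h
  unfold ramp
  have : x / δ ≤ y / δ := by gcongr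
  gcongr


/-- Both ends of the ramp map to `1` on the circle, so the dual function extends continuously by `1`
away from the section. -/
theorem circleExp_ramp_of_le_abs {δ t : ℝ} (hδ : 0 < δ) (ht : δ ≤ |t|) :
    Circle.exp (ramp δ t) = 1 := by
  rcases le_abs.1 ht with h | h
  · have : 1 ≤ t / δ := (one_le_div hδ).2 h
    have : ramp δ t = 0 := by
      unfold ramp
      rw [max_eq_left ((min_le_right _ _).trans (by linarith)), mul_zero]
    rw [this, Circle.exp_zero]
  · have : 1 ≤ -t / δ := (one_le_div hδ).2 h
    rw [neg_div] at this
    have : ramp δ t = 2 * Real.pi := by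
      unfold ramp
      rw [min_eq_left (by linarith), max_eq_right zero_le_one, mul_one]
    rw [this, Circle.exp_two_pi]

/-- A definite gain during the half window after a crossing; it forces lifts to be unbounded. -/
theorem ramp_neg_half {δ : ℝ} (hδ : 0 < δ) : ramp δ (-(δ / 2)) = ramp δ 0 + Real.pi / 2 := by
  unfold ramp
  have h : -(δ / 2) / δ = -(1 / 2) := by field_simp
  rw [h]
  norm_num
  ring

/-- The set `K` is a local section of the flow `φ`, of return time larger than `δ`: near every
point, orbit segments of length `2 * δ` meet `K` at the time given by a continuous function or,
if that is too large, not at all. -/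
def IsLocalSection {R : Type*} [TopologicalSpace R] (φ : Flow ℝ R) (K : Set R) (δ : ℝ) : Prop :=
  ∀ q, ∃ U ∈ 𝓝 q, ∃ F : R → ℝ, ContinuousOn F U ∧
    ∀ p ∈ U, ∀ t, |t| < δ → (φ t p ∈ K ↔ t = F p)

variable {R : Type*} [TopologicalSpace R]

/-- Finitely many neighbourhoods cover the compact space, and the least of their windows works
everywhere. -/
theorem exists_isLocalSection [CompactSpace R] (φ : Flow ℝ R) (K : Set R)
    (h : ∀ q, ∃ δ > 0, ∃ U ∈ 𝓝 q, ∃ F : R → ℝ, ContinuousOn F U ∧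
      ∀ p ∈ U, ∀ t, |t| < δ → (φ t p ∈ K ↔ t = F p)) :
    ∃ δ > 0, IsLocalSection φ K δ := by
  choose δ hδ U hU F hF hK using h
  obtain ⟨s, hs⟩ := CompactSpace.elim_nhds_subcover (fun q => interior (U q))
    (fun q => interior_mem_nhds.2 (hU q))
  obtain ⟨η, hη, hηs⟩ : ∃ η > 0, ∀ q ∈ s, η ≤ δ q := by
    rcases s.eq_empty_or_nonempty with rfl | hne
    · exact ⟨1, one_pos, by simp⟩
    · obtain ⟨q, hq, hq'⟩ := s.exists_min_image δ hne
      exact ⟨δ q, hδ q, hq'⟩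
  refine ⟨η, hη, fun q => ?_⟩
  have : q ∈ ⋃ x ∈ s, interior (U x) := by rw [hs]; trivial
  simp only [Set.mem_iUnion] at this
  obtain ⟨x, hx, hq⟩ := this
  exact ⟨U x, mem_interior_iff_mem_nhds.1 hq, F x, hF x, fun p hp t ht =>
    hK x p hp t (ht.trans_le (hηs x hx))⟩

open Classical in
/-- The circle-valued function dual to a section. -/
noncomputable def sectionMap (φ : Flow ℝ R) (K : Set R) (δ : ℝ) (p : R) : Circle :=
  if h : ∃ t, |t| < δ ∧ φ t p ∈ K then Circle.exp (ramp δ h.choose) else 1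

/-- The time `a` may lie outside the window: then nothing is hit and both sides are `1`. This is
what makes the local time functions describe `sectionMap` across the edge of the window. -/
theorem sectionMap_eq {φ : Flow ℝ R} {K : Set R} {δ : ℝ} (hδ : 0 < δ) {p : R} {a : ℝ}
    (h : ∀ t, |t| < δ → (φ t p ∈ K ↔ t = a)) :
    sectionMap φ K δ p = Circle.exp (ramp δ a) := by
  unfold sectionMap
  split_ifs with h'
  · rw [(h _ h'.choose_spec.1).1 h'.choose_spec.2]
  · refine (circleExp_ramp_of_le_abs hδ (not_lt.1 fun ha => h' ⟨a, ha, (h a ha).2 rfl⟩)).symm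

theorem IsLocalSection.continuous_sectionMap {φ : Flow ℝ R} {K : Set R} {δ : ℝ} (hδ : 0 < δ)
    (h : IsLocalSection φ K δ) : Continuous (sectionMap φ K δ) := by
  refine continuous_iff_continuousAt.2 fun q => ?_
  obtain ⟨U, hU, F, hF, hK⟩ := h q
  have : ContinuousOn (fun p => Circle.exp (ramp δ (F p))) U :=
    Circle.exp.continuous.comp_continuousOn ((continuous_ramp δ).comp_continuousOn hF)
  refine (this.continuousAt hU).congr ?_
  filter_upwards [hU] with p hp using (sectionMap_eq hδ (hK p hp)).symm

theorem IsLocalSection.mono {φ : Flow ℝ R} {K : Set R} {δ δ' : ℝ}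
    (h : IsLocalSection φ K δ) (hle : δ' ≤ δ) : IsLocalSection φ K δ' := fun q => by
  obtain ⟨U, hU, F, hF, hK⟩ := h q
  exact ⟨U, hU, F, hF, fun p hp t ht => hK p hp t (ht.trans_le hle)⟩

/-- Along a short orbit segment, a lift of the dual function is a translate of the ramp. -/
theorem IsLocalSection.lift_eq {φ : Flow ℝ R} {K : Set R} {δ : ℝ} (hδ : 0 < δ)
    (h : IsLocalSection φ K (2 * δ)) {p : R} {γ : ℝ → ℝ} (hγ : Continuous γ)
    (hlift : ∀ t, Circle.exp (γ t) = sectionMap φ K δ (φ t p)) (t₀ : ℝ) :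
    ∃ a, (φ t₀ p ∈ K → a = 0) ∧
      ∀ t, |t| < δ → γ (t₀ + t) - γ t₀ = ramp δ (a - t) - ramp δ a := by
  obtain ⟨U, hU, F, -, hK⟩ := h (φ t₀ p)
  have hq := hK _ (mem_of_mem_nhds hU)
  refine ⟨F (φ t₀ p), fun h0 => ((hq 0 (by simpa using hδ)).1 (by simpa using h0)).symm, ?_⟩
  have hv : ∀ t ∈ Set.Ioo (-δ) δ, ∃ m : ℤ, γ (t₀ + t) - ramp δ (F (φ t₀ p) - t)
      = m * (2 * Real.pi) := by
    intro t ht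
    refine int_mul_two_pi_of_circleExp_eq ?_
    rw [hlift]
    -- A shift by less than `δ` followed by a search of length less than `δ` stays inside the window
    -- `2 * δ`; hence the doubled window in the hypothesis.
    refine sectionMap_eq hδ fun u hu => ?_
    rw [← φ.map_add, show u + (t₀ + t) = (u + t) + t₀ by ring, φ.map_add, hq, eq_sub_iff_add_eq]
    calc |u + t| ≤ |u| + |t| := abs_add_le _ _
      _ < 2 * δ := by linarith [abs_lt.2 ht]
  intro t ht
  have := eq_of_int_mul_two_pi_valued (p := t) (q := 0) isPreconnected_Ioo
    (D := fun t => γ (t₀ + t) - ramp δ (F (φ t₀ p) - t))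
    (by have := continuous_ramp δ; fun_prop) hv (abs_lt.1 ht) ⟨by linarith, hδ⟩
  simp only [add_zero, sub_zero] at this
  linarith

/-- The time left until the crossing falls along the flow and the ramp is antitone, so the lift
rises on segments shorter than `δ`; longer segments are cut into such pieces. -/
theorem IsLocalSection.lift_monotone {φ : Flow ℝ R} {K : Set R} {δ : ℝ} (hδ : 0 < δ)
    (h : IsLocalSection φ K (2 * δ)) {p : R} {γ : ℝ → ℝ} (hγ : Continuous γ)
    (hlift : ∀ t, Circle.exp (γ t) = sectionMap φ K δ (φ t p)) : Monotone γ := by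
  have step : ∀ t₀ t, 0 ≤ t → t < δ → γ t₀ ≤ γ (t₀ + t) := by
    intro t₀ t h0 h1
    obtain ⟨a, -, ha⟩ := h.lift_eq hδ hγ hlift t₀
    have := ha t (by rwa [abs_of_nonneg h0])
    have := ramp_antitone hδ (sub_le_self a h0)
    linarith
  have steps : ∀ (t₀ t : ℝ), 0 ≤ t → t < δ → ∀ n : ℕ, γ t₀ ≤ γ (t₀ + n * t) := by
    intro t₀ t h0 h1 n
    induction n with
    | zero => simp
    | succ n ih =>
      refine ih.trans ((step _ t h0 h1).trans_eq ?_)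
      congr 1; push_cast; ring
  intro x y hxy
  obtain ⟨n, hn⟩ := exists_nat_gt ((y - x) / δ)
  have hn0 : (0 : ℝ) < n := (div_nonneg (sub_nonneg.2 hxy) hδ.le).trans_lt hn
  have := steps x ((y - x) / n) (div_nonneg (sub_nonneg.2 hxy) hn0.le)
    (by rw [div_lt_iff₀ hδ] at hn; rw [div_lt_iff₀ hn0]; linarith) n
  rwa [mul_div_cancel₀ _ hn0.ne', add_sub_cancel] at this

/-- Start where the lift is within `π / 2` of its supremum. By monotonicity nothing is lost up to
the next crossing, and half a window later a further `π / 2` has been gained. -/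
theorem IsLocalSection.not_bddAbove_lift {φ : Flow ℝ R} {K : Set R} {δ : ℝ} (hδ : 0 < δ)
    (h : IsLocalSection φ K (2 * δ)) (hret : ∀ p, ∃ t, 0 < t ∧ φ t p ∈ K) {p : R} {γ : ℝ → ℝ}
    (hγ : Continuous γ) (hlift : ∀ t, Circle.exp (γ t) = sectionMap φ K δ (φ t p)) :
    ¬ BddAbove (Set.range γ) := by
  intro hB
  obtain ⟨_, ⟨t, rfl⟩, ht⟩ := exists_lt_of_lt_csSup (Set.range_nonempty γ)
    (show sSup (Set.range γ) - Real.pi / 2 < sSup (Set.range γ) by linarith [Real.pi_pos])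
  obtain ⟨u, hu, huK⟩ := hret (φ t p)
  rw [← φ.map_add] at huK
  obtain ⟨a, ha, haK⟩ := h.lift_eq hδ hγ hlift (u + t)
  obtain rfl := ha huK
  have h1 := haK (δ / 2) (by rw [abs_of_pos (by positivity)]; linarith)
  rw [zero_sub, ramp_neg_half hδ] at h1
  have h2 := h.lift_monotone hδ hγ hlift (show t ≤ u + t by linarith)
  have h3 := le_csSup hB ⟨u + t + δ / 2, rfl⟩
  linarith

/-- A linear flow on a family of tori whose directions meet the kernel of every integral
cohomology class admits no section without boundary. -/
theorem not_exists_section_of_linear_flow [CompactSpace R] (φ : Flow ℝ R) (K : Set R)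
    (hK : ∀ q, ∃ δ > 0, ∃ U ∈ 𝓝 q, ∃ F : R → ℝ, ContinuousOn F U ∧
      ∀ p ∈ U, ∀ t, |t| < δ → (φ t p ∈ K ↔ t = F p))
    {P : ℝ × ℝ × ℝ → R} (hP : Continuous P)
    (h₁ : ∀ x y s, P (x + 2 * Real.pi, y, s) = P (x, y, s))
    (h₂ : ∀ x y s, P (x, y + 2 * Real.pi, s) = P (x, y, s)) {a b : ℝ → ℝ}
    (hab : ∀ m n : ℤ, ∃ s, m * a s + n * b s = 0)
    (hφ : ∀ t s, φ t (P (0, 0, s)) = P (t * a s, t * b s, s)) :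
    ∃ p, ∀ t, 0 < t → φ t p ∉ K := by
  by_contra! hret
  obtain ⟨δ, hδ, h⟩ := exists_isLocalSection φ K hK
  rw [show δ = 2 * (δ / 2) by ring] at h
  have hδ2 : 0 < δ / 2 := by positivity
  have hc := (h.mono (δ' := δ / 2) (by linarith)).continuous_sectionMap hδ2
  obtain ⟨s, γ, hγ, hlift, hB⟩ := exists_bddAbove_lift (hc.comp hP)
    (fun x y s => by simp [h₁]) (fun x y s => by simp [h₂]) hab
  exact h.not_bddAbove_lift hδ2 hret hγ (p := P (0, 0, s))
    (fun t => by rw [hφ]; exact hlift t) hB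

/-! ### Toric domains that are star-shaped: the plane curve -/

/-- The homogeneous function on the quadrant with profile `e` on the simplex `x₀ + x₁ = 1`. -/
noncomputable def gauge (e : ℝ → ℝ) (x : Plane) : ℝ := (x 0 + x 1) * e (x 0 / (x 0 + x 1))

/-- The parametrization of the level set `gauge e = 1` by the ratio `x₀ / (x₀ + x₁)`. -/
noncomputable def profileCurve (e : ℝ → ℝ) (s : ℝ) : Plane := !₂[s / e s, (1 - s) / e s]

/-- The sublevel set `gauge e ≤ 1`, as the cone over the profile curve. -/
noncomputable def profileRegion (e : ℝ → ℝ) : Set Plane :=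
  (fun p : ℝ × ℝ => p.1 • profileCurve e p.2) '' (Set.Icc 0 1 ×ˢ Set.Icc 0 1)

@[simp] theorem profileCurve_zero (e : ℝ → ℝ) (s : ℝ) : profileCurve e s 0 = s / e s := rfl
@[simp] theorem profileCurve_one (e : ℝ → ℝ) (s : ℝ) : profileCurve e s 1 = (1 - s) / e s := rfl

theorem plane_ext {x y : Plane} (h₀ : x 0 = y 0) (h₁ : x 1 = y 1) : x = y := by
  ext i; fin_cases i <;> assumption

variable {e : ℝ → ℝ}

theorem ContDiff.profileCurve (he : ContDiff ℝ ∞ e) (hpos : ∀ s, 0 < e s) :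
    ContDiff ℝ ∞ (profileCurve e) := by
  rw [contDiff_euclidean]
  intro i
  fin_cases i
  · exact contDiff_id.div he fun s => (hpos s).ne'
  · exact (contDiff_const.sub contDiff_id).div he fun s => (hpos s).ne'

theorem profileCurve_add (hpos : ∀ s, 0 < e s) (s : ℝ) :
    profileCurve e s 0 + profileCurve e s 1 = 1 / e s := by
  have := (hpos s).ne'
  simp only [profileCurve_zero, profileCurve_one]
  field_simp
  ring

theorem profileCurve_ratio (hpos : ∀ s, 0 < e s) (s : ℝ) :
    profileCurve e s 0 / (profileCurve e s 0 + profileCurve e s 1) = s := by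
  have := (hpos s).ne'
  rw [profileCurve_add hpos, profileCurve_zero]
  field_simp

theorem gauge_smul (r : ℝ) (x : Plane) : gauge e (r • x) = r * gauge e x := by
  rcases eq_or_ne r 0 with rfl | hr
  · simp [gauge]
  · simp only [gauge, PiLp.smul_apply, smul_eq_mul]
    rw [← mul_add, mul_div_mul_left _ _ hr, mul_assoc]

theorem gauge_profileCurve (hpos : ∀ s, 0 < e s) (s : ℝ) : gauge e (profileCurve e s) = 1 := by
  have := (hpos s).ne'
  unfold gauge
  rw [profileCurve_ratio hpos, profileCurve_add hpos]
  field_simp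

theorem add_pos_of_mem_quadrant {x : Plane} (hx : x ∈ quadrant) (h0 : x ≠ 0) : 0 < x 0 + x 1 := by
  obtain ⟨h₀, h₁⟩ := hx
  rcases h₀.eq_or_lt with h | h
  · rcases h₁.eq_or_lt with h' | h'
    · exact (h0 (plane_ext (by simp [← h]) (by simp [← h']))).elim
    · linarith
  · linarith

theorem gauge_pos (hpos : ∀ s, 0 < e s) {x : Plane} (hx : x ∈ quadrant) (h0 : x ≠ 0) :
    0 < gauge e x := mul_pos (add_pos_of_mem_quadrant hx h0) (hpos _)

theorem ratio_mem_Icc {x : Plane} (hx : x ∈ quadrant) :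
    x 0 / (x 0 + x 1) ∈ Set.Icc (0 : ℝ) 1 :=
  ⟨div_nonneg hx.1 (add_nonneg hx.1 hx.2),
    div_le_one_of_le₀ (le_add_of_nonneg_right hx.2) (add_nonneg hx.1 hx.2)⟩

/-- Polar coordinates on the quadrant. At the origin the ratio is a junk value, but the factor
`gauge e 0 = 0` makes it harmless. -/
theorem gauge_smul_profileCurve (hpos : ∀ s, 0 < e s) {x : Plane} (hx : x ∈ quadrant) :
    gauge e x • profileCurve e (x 0 / (x 0 + x 1)) = x := by
  rcases eq_or_ne x 0 with rfl | h0
  · simp [gauge]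
  have h1 := (add_pos_of_mem_quadrant hx h0).ne'
  have h2 := (hpos (x 0 / (x 0 + x 1))).ne'
  refine plane_ext ?_ ?_ <;>
  · simp only [gauge, PiLp.smul_apply, profileCurve_zero, profileCurve_one, smul_eq_mul]
    field_simp
    try ring

theorem profileCurve_mem_quadrant (hpos : ∀ s, 0 < e s) {s : ℝ} (hs : s ∈ Set.Icc (0 : ℝ) 1) :
    profileCurve e s ∈ quadrant :=
  ⟨div_nonneg hs.1 (hpos s).le, div_nonneg (sub_nonneg.2 hs.2) (hpos s).le⟩

theorem mem_image_profileCurve (hpos : ∀ s, 0 < e s) {x : Plane} :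
    x ∈ profileCurve e '' Set.Icc 0 1 ↔ x ∈ quadrant ∧ gauge e x = 1 := by
  constructor
  · rintro ⟨s, hs, rfl⟩
    exact ⟨profileCurve_mem_quadrant hpos hs, gauge_profileCurve hpos s⟩
  · rintro ⟨hx, h1⟩
    refine ⟨_, ratio_mem_Icc hx, ?_⟩
    have := gauge_smul_profileCurve hpos hx
    rwa [h1, one_smul] at this

theorem mem_profileRegion (hpos : ∀ s, 0 < e s) {x : Plane} :
    x ∈ profileRegion e ↔ x ∈ quadrant ∧ gauge e x ≤ 1 := by
  constructor
  · rintro ⟨⟨r, s⟩, ⟨hr, hs⟩, rfl⟩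
    have := profileCurve_mem_quadrant hpos hs
    refine ⟨⟨mul_nonneg hr.1 this.1, mul_nonneg hr.1 this.2⟩, ?_⟩
    simp only [gauge_smul, gauge_profileCurve hpos, mul_one]
    exact hr.2
  · rintro ⟨hx, h1⟩
    refine ⟨(gauge e x, x 0 / (x 0 + x 1)), ⟨⟨?_, h1⟩, ratio_mem_Icc hx⟩,
      gauge_smul_profileCurve hpos hx⟩
    exact mul_nonneg (add_nonneg hx.1 hx.2) (hpos _).le

theorem isCompact_profileRegion (he : ContDiff ℝ ∞ e) (hpos : ∀ s, 0 < e s) :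
    IsCompact (profileRegion e) := by
  have := (ContDiff.profileCurve he hpos).continuous
  exact (isCompact_Icc.prod isCompact_Icc).image (by fun_prop)

/-- At the origin the ratio has no limit, but `e` is bounded on `[0, 1]` and the factor `x₀ + x₁`
tends to zero. -/
theorem continuousOn_gauge (he : Continuous e) : ContinuousOn (gauge e) quadrant := by
  intro x hx
  rcases eq_or_ne x 0 with rfl | h0
  · obtain ⟨B, hB⟩ := (isCompact_Icc (a := (0 : ℝ)) (b := 1)).exists_bound_of_continuousOn
      he.continuousOn
    have h : gauge e 0 = 0 := by simp [gauge]
    rw [ContinuousWithinAt, h]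
    refine squeeze_zero_norm' (a := fun x : Plane => |x 0 + x 1| * B) ?_ ?_
    · filter_upwards [self_mem_nhdsWithin] with y hy
      rw [gauge, norm_mul]
      exact mul_le_mul_of_nonneg_left (hB _ (ratio_mem_Icc hy)) (abs_nonneg _)
    · refine Filter.Tendsto.mono_left ?_ nhdsWithin_le_nhds
      have : Continuous fun x : Plane => |x 0 + x 1| * B := by fun_prop
      simpa using this.tendsto 0
  · have h1 := (add_pos_of_mem_quadrant hx h0).ne'
    refine ContinuousAt.continuousWithinAt ?_
    have h2 : ContinuousAt (fun y : Plane => y 0 + y 1) x := by fun_prop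
    have h3 : ContinuousAt (fun y : Plane => y 0) x := by fun_prop
    exact h2.mul (he.continuousAt.comp (h3.div h2 h1))

/-- A limit of exterior points has gauge at least `1` by continuity; conversely a point of gauge `1`
is the limit of its dilates by `r > 1`, whose gauge is `r`. -/
theorem profileRegion_inter_closure (he : Continuous e) (hpos : ∀ s, 0 < e s) :
    profileRegion e ∩ closure (quadrant \ profileRegion e) = profileCurve e '' Set.Icc 0 1 := by
  ext x
  rw [mem_image_profileCurve hpos, Set.mem_inter_iff, mem_profileRegion hpos]
  constructor
  · rintro ⟨⟨hx, h1⟩, hc⟩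
    refine ⟨hx, h1.antisymm ?_⟩
    have hne : (𝓝[quadrant \ profileRegion e] x).NeBot := mem_closure_iff_nhdsWithin_neBot.1 hc
    have ht := (continuousOn_gauge he x hx).mono_left
      (nhdsWithin_mono x (Set.sdiff_subset (t := profileRegion e)))
    refine ge_of_tendsto ht ?_
    filter_upwards [self_mem_nhdsWithin] with y hy
    by_contra! h
    exact hy.2 ((mem_profileRegion hpos).2 ⟨hy.1, h.le⟩)
  · rintro ⟨hx, h1⟩
    refine ⟨⟨hx, h1.le⟩, ?_⟩
    have ht : Filter.Tendsto (fun r : ℝ => r • x) (𝓝[>] 1) (𝓝 x) := by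
      have : Continuous fun r : ℝ => r • x := by fun_prop
      simpa using (this.tendsto 1).mono_left nhdsWithin_le_nhds
    refine mem_closure_of_tendsto ht ?_
    filter_upwards [self_mem_nhdsWithin] with r hr
    have hr' : (1 : ℝ) < r := hr
    refine ⟨⟨mul_nonneg (by linarith) hx.1, mul_nonneg (by linarith) hx.2⟩, fun h => ?_⟩
    have := ((mem_profileRegion hpos).1 h).2
    rw [gauge_smul, h1] at this
    linarith

theorem isBoundedByCurve_profile (he : ContDiff ℝ ∞ e) (hpos : ∀ s, 0 < e s) :
    IsBoundedByCurve (profileRegion e) (profileCurve e) where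
  isClosed := (isCompact_profileRegion he hpos).isClosed
  isBounded := (isCompact_profileRegion he hpos).isBounded
  subset_quadrant _ hx := ((mem_profileRegion hpos).1 hx).1
  zero_mem := (mem_profileRegion hpos).2 ⟨⟨le_rfl, le_rfl⟩, by simp [gauge]⟩
  smooth := (ContDiff.profileCurve he hpos).contDiffOn
  injOn s _ t _ h := by rw [← profileCurve_ratio hpos s, h, profileCurve_ratio hpos t]
  deriv_ne_zero s hs := by
    have hd := ((ContDiff.profileCurve he hpos).differentiable (by simp) s).hasDerivAt
    rw [hd.hasDerivWithinAt.derivWithin (uniqueDiffOn_Icc zero_lt_one s hs)]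
    intro h
    rw [h] at hd
    have h0 : HasDerivAt (fun s => profileCurve e s 0) 0 s :=
      ((EuclideanSpace.proj 0 : Plane →L[ℝ] ℝ).hasFDerivAt.comp_hasDerivAt s hd).congr_deriv
        (map_zero _)
    have h1 : HasDerivAt (fun s => profileCurve e s 1) 0 s :=
      ((EuclideanSpace.proj 1 : Plane →L[ℝ] ℝ).hasFDerivAt.comp_hasDerivAt s hd).congr_deriv
        (map_zero _)
    have hne : profileCurve e s 0 + profileCurve e s 1 ≠ 0 := by
      rw [profileCurve_add hpos]; exact (one_div_pos.2 (hpos s)).ne'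
    have := h0.div (h0.add h1) hne
    -- The ratio of coordinates recovers the parameter, so a vanishing velocity would give the
    -- identity derivative zero.
    have h2 : HasDerivAt (fun s : ℝ => s) 0 s := by
      refine (this.congr_of_eventuallyEq ?_).congr_deriv (by simp)
      exact Filter.Eventually.of_forall fun t => (profileCurve_ratio hpos t).symm
    exact zero_ne_one (h2.unique (hasDerivAt_id' s))
  start := ⟨by simp, by simpa using hpos 0⟩
  finish := ⟨by simpa using hpos 1, by simp⟩
  inside s hs := ⟨div_pos hs.1 (hpos s), div_pos (sub_pos.2 hs.2) (hpos s)⟩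
  boundary_eq := profileRegion_inter_closure he.continuous hpos

/-! ### The quadratic defining function of the hypersurface -/

/-- The linear map `diag(a, b)` with real entries. -/
noncomputable def diag (a b : ℝ) (z : C2) : C2 := !₂[(a : ℂ) * z 0, (b : ℂ) * z 1]

@[simp] theorem diag_zero (a b : ℝ) (z : C2) : diag a b z 0 = a * z 0 := rfl
@[simp] theorem diag_one (a b : ℝ) (z : C2) : diag a b z 1 = b * z 1 := rfl

theorem C2_ext {z w : C2} (h₀ : z 0 = w 0) (h₁ : z 1 = w 1) : z = w := by
  ext i; fin_cases i <;> assumption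

theorem inner_C2 (z w : C2) : inner ℝ z w = (z 0).re * (w 0).re + (z 0).im * (w 0).im +
    ((z 1).re * (w 1).re + (z 1).im * (w 1).im) := by
  rw [PiLp.inner_apply]
  simp [Fin.sum_univ_two, Complex.inner]
  ring

theorem norm_sq_C2 (z : C2) : ‖z‖ ^ 2 = ‖z 0‖ ^ 2 + ‖z 1‖ ^ 2 := by
  rw [EuclideanSpace.norm_sq_eq, Fin.sum_univ_two]

theorem norm_sq_add_pos {z : C2} (hz : z ≠ 0) : 0 < ‖z 0‖ ^ 2 + ‖z 1‖ ^ 2 := by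
  rw [← norm_sq_C2]; positivity

theorem diag_smul (c a b : ℝ) (z : C2) : c • diag a b z = diag (c * a) (c * b) z :=
  C2_ext (by simp [mul_assoc]) (by simp [mul_assoc])

theorem inner_diag_diag (a b c d : ℝ) (z : C2) :
    inner ℝ (diag a b z) (diag c d z) = a * c * ‖z 0‖ ^ 2 + b * d * ‖z 1‖ ^ 2 := by
  simp only [inner_C2, diag_zero, diag_one, Complex.sq_norm, Complex.normSq_apply,
    Complex.re_ofReal_mul, Complex.im_ofReal_mul]
  ring

theorem diag_one_one (z : C2) : diag 1 1 z = z := C2_ext (by simp) (by simp)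

theorem inner_diag_self (a b : ℝ) (z : C2) :
    inner ℝ (diag a b z) z = a * ‖z 0‖ ^ 2 + b * ‖z 1‖ ^ 2 := by
  have := inner_diag_diag a b 1 1 z
  rwa [diag_one_one, mul_one, mul_one] at this

theorem inner_diag_I_smul_diag (a b c d : ℝ) (z : C2) :
    inner ℝ (diag a b z) (Complex.I • diag c d z) = 0 := by
  simp only [inner_C2, PiLp.smul_apply, smul_eq_mul, Complex.I_mul_re, Complex.I_mul_im, diag_zero,
    diag_one, Complex.re_ofReal_mul, Complex.im_ofReal_mul]
  ring

theorem inner_self_I_smul_diag (c d : ℝ) (z : C2) :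
    inner ℝ z (Complex.I • diag c d z) = 0 := by
  simpa [diag_one_one] using inner_diag_I_smul_diag 1 1 c d z

theorem moment_zero_apply (z : C2) : moment z 0 = Real.pi * ‖z 0‖ ^ 2 := rfl
theorem moment_one_apply (z : C2) : moment z 1 = Real.pi * ‖z 1‖ ^ 2 := rfl

theorem moment_mem_quadrant (z : C2) : moment z ∈ quadrant :=
  ⟨by rw [moment_zero_apply]; positivity, by rw [moment_one_apply]; positivity⟩

theorem moment_smul (r : ℝ) (z : C2) : moment (r • z) = r ^ 2 • moment z :=
  plane_ext
    (by simp [moment_zero_apply, mul_pow]; ring)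
    (by simp [moment_one_apply, mul_pow]; ring)

theorem moment_ne_zero {z : C2} (hz : z ≠ 0) : moment z ≠ 0 := by
  intro h
  have h1 := norm_sq_add_pos hz
  have h2 : moment z 0 + moment z 1 = 0 := by rw [h]; simp
  rw [moment_zero_apply, moment_one_apply, ← mul_add] at h2
  have := Real.pi_pos
  exact (mul_pos this h1).ne' h2

/-- The square of the Minkowski functional of the toric domain. -/
noncomputable def toricGauge (e : ℝ → ℝ) (z : C2) : ℝ := gauge e (moment z)

/-- `|z₀|² / |z|²`. -/
noncomputable def zratio (z : C2) : ℝ := ‖z 0‖ ^ 2 / (‖z 0‖ ^ 2 + ‖z 1‖ ^ 2)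

/-- The partial derivative of `gauge e` with respect to `x₀`, as a function of the ratio. -/
noncomputable def slope₀ (e : ℝ → ℝ) (s : ℝ) : ℝ := e s + (1 - s) * deriv e s

/-- The partial derivative of `gauge e` with respect to `x₁`, as a function of the ratio. -/
noncomputable def slope₁ (e : ℝ → ℝ) (s : ℝ) : ℝ := e s - s * deriv e s

/-- The gradient of `toricGauge e`. -/
noncomputable def toricGrad (e : ℝ → ℝ) (z : C2) : C2 :=
  diag (2 * Real.pi * slope₀ e (zratio z)) (2 * Real.pi * slope₁ e (zratio z)) z

theorem moment_ratio (z : C2) : moment z 0 / (moment z 0 + moment z 1) = zratio z := by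
  rw [moment_zero_apply, moment_one_apply, ← mul_add, mul_div_mul_left _ _ Real.pi_ne_zero]; rfl

theorem toricGauge_eq (z : C2) :
    toricGauge e z = Real.pi * (‖z 0‖ ^ 2 + ‖z 1‖ ^ 2) * e (zratio z) := by
  rw [toricGauge, gauge, moment_ratio, moment_zero_apply, moment_one_apply, ← mul_add]

theorem toricGauge_pos (hpos : ∀ s, 0 < e s) {z : C2} (hz : z ≠ 0) : 0 < toricGauge e z :=
  gauge_pos hpos (moment_mem_quadrant z) (moment_ne_zero hz)

theorem toricGauge_zero : toricGauge e 0 = 0 := by simp [toricGauge_eq]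

theorem toricGauge_smul (r : ℝ) (z : C2) : toricGauge e (r • z) = r ^ 2 * toricGauge e z := by
  rw [toricGauge, moment_smul, gauge_smul, toricGauge]

theorem mem_toricBoundary (hpos : ∀ s, 0 < e s) {z : C2} :
    z ∈ toricBoundary (profileCurve e) ↔ toricGauge e z = 1 := by
  rw [toricBoundary, Set.mem_preimage, mem_image_profileCurve hpos]
  exact and_iff_right (moment_mem_quadrant z)

theorem mem_toricDomain (hpos : ∀ s, 0 < e s) {z : C2} :
    z ∈ toricDomain (profileRegion e) ↔ toricGauge e z ≤ 1 := by
  rw [toricDomain, Set.mem_preimage, mem_profileRegion hpos]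
  exact and_iff_right (moment_mem_quadrant z)

theorem ne_zero_of_mem (hpos : ∀ s, 0 < e s) {z : C2} (hz : z ∈ toricBoundary (profileCurve e)) :
    z ≠ 0 := by
  rintro rfl
  rw [mem_toricBoundary hpos, toricGauge_zero] at hz
  exact zero_ne_one hz

/-- Euler's identity for the degree one gauge at `(s, 1 - s)`. -/
theorem slope_euler (s : ℝ) : s * slope₀ e s + (1 - s) * slope₁ e s = e s := by
  unfold slope₀ slope₁; ring

theorem zratio_mul {z : C2} (hz : z ≠ 0) :
    zratio z * (‖z 0‖ ^ 2 + ‖z 1‖ ^ 2) = ‖z 0‖ ^ 2 :=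
  div_mul_cancel₀ _ (norm_sq_add_pos hz).ne'

/-- Euler's identity in degree two. It yields transversality to the position vector and normalizes
the Reeb field. -/
theorem inner_toricGrad_self {z : C2} (hz : z ≠ 0) :
    inner ℝ (toricGrad e z) z = 2 * toricGauge e z := by
  have h1 := zratio_mul hz
  rw [toricGrad, inner_diag_self, toricGauge_eq, ← slope_euler (e := e)]
  linear_combination 2 * Real.pi * (slope₁ e (zratio z) - slope₀ e (zratio z)) * h1

theorem toricGrad_ne_zero (hpos : ∀ s, 0 < e s) {z : C2} (hz : z ≠ 0) : toricGrad e z ≠ 0 := by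
  intro h
  have h1 := inner_toricGrad_self (e := e) hz
  rw [h, inner_zero_left] at h1
  linarith [toricGauge_pos hpos hz]

theorem zratio_smul {r : ℝ} (hr : r ≠ 0) (z : C2) : zratio (r • z) = zratio z := by
  simp only [zratio, PiLp.smul_apply, norm_smul, mul_pow, ← mul_add]
  exact mul_div_mul_left _ _ (by positivity)

theorem diag_real_smul (a b r : ℝ) (z : C2) : diag a b (r • z) = r • diag a b z :=
  C2_ext (by simp; ring) (by simp; ring)

theorem toricGrad_smul {r : ℝ} (hr : r ≠ 0) (z : C2) :
    toricGrad e (r • z) = r • toricGrad e z := by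
  rw [toricGrad, zratio_smul hr, diag_real_smul, toricGrad]

theorem contDiff_norm_coord_sq (i : Fin 2) : ContDiff ℝ ∞ fun z : C2 => ‖z i‖ ^ 2 :=
  (((EuclideanSpace.proj i : C2 →L[ℂ] ℂ).restrictScalars ℝ).contDiff).norm_sq ℝ

theorem contDiffAt_zratio {z : C2} (hz : z ≠ 0) : ContDiffAt ℝ ∞ zratio z :=
  (contDiff_norm_coord_sq 0).contDiffAt.div
    ((contDiff_norm_coord_sq 0).add (contDiff_norm_coord_sq 1)).contDiffAt (norm_sq_add_pos hz).ne'

theorem ContDiff.deriv_infty (he : ContDiff ℝ ∞ e) : ContDiff ℝ ∞ (deriv e) :=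
  (contDiff_infty_iff_deriv.1 he).2

theorem ContDiff.slope₀ (he : ContDiff ℝ ∞ e) : ContDiff ℝ ∞ (slope₀ e) :=
  he.add ((contDiff_const.sub contDiff_id).mul (ContDiff.deriv_infty he))

theorem ContDiff.slope₁ (he : ContDiff ℝ ∞ e) : ContDiff ℝ ∞ (slope₁ e) :=
  he.sub (contDiff_id.mul (ContDiff.deriv_infty he))

theorem contDiffAt_toricGauge (he : ContDiff ℝ ∞ e) {z : C2} (hz : z ≠ 0) :
    ContDiffAt ℝ ∞ (toricGauge e) z := by
  have h : toricGauge e = fun z => Real.pi * (‖z 0‖ ^ 2 + ‖z 1‖ ^ 2) * e (zratio z) :=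
    funext toricGauge_eq
  rw [h]
  exact (contDiffAt_const.mul
    ((contDiff_norm_coord_sq 0).add (contDiff_norm_coord_sq 1)).contDiffAt).mul
    (he.contDiffAt.comp z (contDiffAt_zratio hz))

theorem contDiffAt_diag {a b : C2 → ℝ} {n : WithTop ℕ∞} {z : C2} (ha : ContDiffAt ℝ n a z)
    (hb : ContDiffAt ℝ n b z) : ContDiffAt ℝ n (fun z => diag (a z) (b z) z) z := by
  have h (i : Fin 2) : ContDiffAt ℝ n (fun z : C2 => z i) z :=
    ((EuclideanSpace.proj i : C2 →L[ℂ] ℂ).restrictScalars ℝ).contDiff.contDiffAt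
  have hof : ContDiff ℝ n Complex.ofReal := Complex.ofRealCLM.contDiff
  rw [contDiffAt_piLp]
  intro i
  fin_cases i
  · exact (hof.contDiffAt.comp z ha).mul (h 0)
  · exact (hof.contDiffAt.comp z hb).mul (h 1)

theorem contDiffAt_toricGrad (he : ContDiff ℝ ∞ e) {z : C2} (hz : z ≠ 0) :
    ContDiffAt ℝ ∞ (toricGrad e) z :=
  contDiffAt_diag
    (contDiffAt_const.mul ((ContDiff.slope₀ he).contDiffAt.comp z (contDiffAt_zratio hz)))
    (contDiffAt_const.mul ((ContDiff.slope₁ he).contDiffAt.comp z (contDiffAt_zratio hz)))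

theorem hasFDerivAt_norm_coord_sq (i : Fin 2) (z : C2) : HasFDerivAt (fun z : C2 => ‖z i‖ ^ 2)
    (2 • (innerSL ℝ (z i)).comp ((EuclideanSpace.proj i : C2 →L[ℂ] ℂ).restrictScalars ℝ)) z :=
  ((EuclideanSpace.proj i : C2 →L[ℂ] ℂ).restrictScalars ℝ).hasFDerivAt.norm_sq

theorem hasFDerivAt_toricGauge (he : ContDiff ℝ ∞ e) {z : C2} (hz : z ≠ 0) :
    HasFDerivAt (toricGauge e) (innerSL ℝ (toricGrad e z)) z := by
  have h : toricGauge e = fun z => Real.pi * (‖z 0‖ ^ 2 + ‖z 1‖ ^ 2) * e (zratio z) :=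
    funext toricGauge_eq
  have hne := (norm_sq_add_pos hz).ne'
  have hA := hasFDerivAt_norm_coord_sq 0 z
  have hs := (hA.add (hasFDerivAt_norm_coord_sq 1 z))
  have hr : HasFDerivAt zratio _ z := hA.mul ((hasDerivAt_inv hne).comp_hasFDerivAt z hs)
  have hd := (he.differentiable (by simp) (zratio z)).hasDerivAt
  have := (hs.const_mul Real.pi).mul (hd.comp_hasFDerivAt z hr)
  rw [h]
  refine this.congr_fderiv ?_
  ext v
  simp [inner_C2, toricGrad, slope₀, slope₁, Complex.inner, smul_eq_mul]
  simp only [zratio]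
  field_simp
  ring

/-! ### Star-shapedness and the standard field -/

/-- The gauge is constant on the hypersurface, so zero is also a derivative of it within that set,
and two such derivatives agree on the tangent cone. -/
theorem inner_toricGrad_of_mem_tangentConeAt (he : ContDiff ℝ ∞ e) (hpos : ∀ s, 0 < e s)
    {z v : C2} (hz : z ∈ toricBoundary (profileCurve e))
    (hv : v ∈ tangentConeAt ℝ (toricBoundary (profileCurve e)) z) :
    inner ℝ (toricGrad e z) v = 0 := by
  have h1 := (hasFDerivAt_toricGauge he (ne_zero_of_mem hpos hz)).hasFDerivWithinAt
    (s := toricBoundary (profileCurve e))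
  have h2 : HasFDerivWithinAt (toricGauge e) (0 : C2 →L[ℝ] ℝ) (toricBoundary (profileCurve e)) z :=
    (hasFDerivWithinAt_const (1 : ℝ) z _).congr (fun w hw => (mem_toricBoundary hpos).1 hw)
      ((mem_toricBoundary hpos).1 hz)
  exact HasFDerivWithinAt.unique_on h1 h2 hv

theorem isStarShaped_profile (he : ContDiff ℝ ∞ e) (hpos : ∀ s, 0 < e s) :
    IsStarShaped (toricBoundary (profileCurve e)) := by
  refine ⟨fun u hu => ?_, fun z hz hz' => ?_⟩
  · have hQ := toricGauge_pos hpos hu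
    refine ⟨(√(toricGauge e u))⁻¹, ⟨by positivity, ?_⟩, ?_⟩
    · rw [mem_toricBoundary hpos, toricGauge_smul, inv_pow, Real.sq_sqrt hQ.le,
        inv_mul_cancel₀ hQ.ne']
    · rintro r ⟨hr, hr'⟩
      rw [mem_toricBoundary hpos, toricGauge_smul] at hr'
      rw [← Real.sqrt_inv, ← one_div, ← eq_div_of_mul_eq hQ.ne' hr', Real.sqrt_sq hr.le]
  · have h1 := inner_toricGrad_of_mem_tangentConeAt he hpos hz hz'
    rw [inner_toricGrad_self (ne_zero_of_mem hpos hz), (mem_toricBoundary hpos).1 hz] at h1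
    norm_num at h1

/-- The outer unit normal. -/
noncomputable def toricNormal (e : ℝ → ℝ) (z : C2) : C2 := ‖toricGrad e z‖⁻¹ • toricGrad e z

/-- The standard Hamiltonian vector field. -/
noncomputable def toricField (e : ℝ → ℝ) (z : C2) : C2 := Complex.I • toricNormal e z

theorem eventually_lt_of_hasDerivAt_pos {g : ℝ → ℝ} {g' x : ℝ} (h : HasDerivAt g g' x)
    (hg : 0 < g') : ∀ᶠ t in 𝓝[>] x, g x < g t := by
  have h1 := (hasDerivAt_iff_tendsto_slope.1 h).eventually (lt_mem_nhds hg)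
  have h2 : ∀ᶠ t in 𝓝[>] x, 0 < slope g x t :=
    h1.filter_mono (nhdsWithin_mono x fun t ht => ne_of_gt ht)
  filter_upwards [h2, self_mem_nhdsWithin] with t ht ht'
  exact (slope_pos_iff_of_le (le_of_lt ht')).1 ht

theorem isOuterUnitNormal_toricNormal (he : ContDiff ℝ ∞ e) (hpos : ∀ s, 0 < e s) {z : C2}
    (hz : z ∈ toricBoundary (profileCurve e)) :
    IsOuterUnitNormal (toricDomain (profileRegion e)) (toricBoundary (profileCurve e)) z
      (toricNormal e z) := by
  have hz0 := ne_zero_of_mem hpos hz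
  have hg := norm_pos_iff.2 (toricGrad_ne_zero hpos hz0)
  refine ⟨?_, fun v hv => ?_, ?_⟩
  · rw [toricNormal, norm_smul, norm_inv, norm_norm, inv_mul_cancel₀ hg.ne']
  · rw [toricNormal, real_inner_smul_left, inner_toricGrad_of_mem_tangentConeAt he hpos hz hv,
      mul_zero]
  · have hl : HasDerivAt (fun t : ℝ => z + t • toricNormal e z) (toricNormal e z) 0 := by
      simpa using ((hasDerivAt_id (0 : ℝ)).smul_const (toricNormal e z)).const_add z
    have hf : HasFDerivAt (toricGauge e) (innerSL ℝ (toricGrad e z))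
        (z + (0 : ℝ) • toricNormal e z) := by
      simpa using hasFDerivAt_toricGauge he hz0
    have hd := hf.comp_hasDerivAt 0 hl
    have hv : (innerSL ℝ (toricGrad e z)) (toricNormal e z) = ‖toricGrad e z‖ := by
      rw [innerSL_apply_apply, toricNormal, real_inner_smul_right, real_inner_self_eq_norm_sq]
      field_simp
    rw [hv] at hd
    filter_upwards [eventually_lt_of_hasDerivAt_pos hd hg] with t ht
    rw [mem_toricDomain hpos, not_le]
    simpa [(mem_toricBoundary hpos).1 hz] using ht

theorem isStandardField_toricField (he : ContDiff ℝ ∞ e) (hpos : ∀ s, 0 < e s) :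
    IsStandardField (toricDomain (profileRegion e)) (toricBoundary (profileCurve e))
      (toricField e) := fun _ hz =>
  ⟨_, isOuterUnitNormal_toricNormal he hpos hz, rfl⟩

/-! ### The flow -/

/-- The action of the two-torus. -/
noncomputable def rot (a b : ℝ) (z : C2) : C2 :=
  !₂[Complex.exp (a * Complex.I) * z 0, Complex.exp (b * Complex.I) * z 1]

@[simp] theorem rot_apply_zero (a b : ℝ) (z : C2) :
    rot a b z 0 = Complex.exp (a * Complex.I) * z 0 := rfl
@[simp] theorem rot_apply_one (a b : ℝ) (z : C2) :
    rot a b z 1 = Complex.exp (b * Complex.I) * z 1 := rfl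

theorem rot_zero (z : C2) : rot 0 0 z = z := C2_ext (by simp) (by simp)

theorem rot_rot (a b c d : ℝ) (z : C2) : rot a b (rot c d z) = rot (a + c) (b + d) z :=
  C2_ext (by simp [add_mul, Complex.exp_add, mul_assoc])
    (by simp [add_mul, Complex.exp_add, mul_assoc])

theorem norm_rot_zero (a b : ℝ) (z : C2) : ‖rot a b z 0‖ = ‖z 0‖ := by
  simp [Complex.norm_exp_ofReal_mul_I]

theorem norm_rot_one (a b : ℝ) (z : C2) : ‖rot a b z 1‖ = ‖z 1‖ := by
  simp [Complex.norm_exp_ofReal_mul_I]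

theorem moment_rot (a b : ℝ) (z : C2) : moment (rot a b z) = moment z := by
  unfold moment; rw [norm_rot_zero, norm_rot_one]

/-- The angular speed of the flow in the first coordinate. -/
noncomputable def speed₀ (e : ℝ → ℝ) (z : C2) : ℝ :=
  ‖toricGrad e z‖⁻¹ * (2 * Real.pi * slope₀ e (zratio z))

/-- The angular speed of the flow in the second coordinate. -/
noncomputable def speed₁ (e : ℝ → ℝ) (z : C2) : ℝ :=
  ‖toricGrad e z‖⁻¹ * (2 * Real.pi * slope₁ e (zratio z))

theorem toricNormal_eq (z : C2) : toricNormal e z = diag (speed₀ e z) (speed₁ e z) z :=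
  diag_smul _ _ _ z

theorem norm_sq_eq_of_moment_eq {z w : C2} (h : moment z = moment w) :
    ‖z 0‖ ^ 2 = ‖w 0‖ ^ 2 ∧ ‖z 1‖ ^ 2 = ‖w 1‖ ^ 2 := by
  have h0 : moment z 0 = moment w 0 := by rw [h]
  have h1 : moment z 1 = moment w 1 := by rw [h]
  exact ⟨mul_left_cancel₀ Real.pi_ne_zero h0, mul_left_cancel₀ Real.pi_ne_zero h1⟩

theorem zratio_congr {z w : C2} (h : moment z = moment w) : zratio z = zratio w := by
  obtain ⟨h0, h1⟩ := norm_sq_eq_of_moment_eq h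
  rw [zratio, zratio, h0, h1]

theorem norm_toricGrad_congr {z w : C2} (h : moment z = moment w) :
    ‖toricGrad e z‖ = ‖toricGrad e w‖ := by
  obtain ⟨h0, h1⟩ := norm_sq_eq_of_moment_eq h
  rw [← sq_eq_sq₀ (norm_nonneg _) (norm_nonneg _), ← real_inner_self_eq_norm_sq,
    ← real_inner_self_eq_norm_sq, toricGrad, toricGrad, inner_diag_diag, inner_diag_diag, h0, h1,
    zratio_congr h]

theorem speed₀_congr {z w : C2} (h : moment z = moment w) : speed₀ e z = speed₀ e w := by
  rw [speed₀, speed₀, norm_toricGrad_congr h, zratio_congr h]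

theorem speed₁_congr {z w : C2} (h : moment z = moment w) : speed₁ e z = speed₁ e w := by
  rw [speed₁, speed₁, norm_toricGrad_congr h, zratio_congr h]

/-- The standard Hamiltonian flow. -/
noncomputable def toricFlow (e : ℝ → ℝ) (t : ℝ) (z : C2) : C2 :=
  rot (t * speed₀ e z) (t * speed₁ e z) z

theorem moment_toricFlow (t : ℝ) (z : C2) : moment (toricFlow e t z) = moment z := moment_rot _ _ z

theorem toricFlow_zero (z : C2) : toricFlow e 0 z = z := by simp [toricFlow, rot_zero]

/-- The angular speeds depend only on the moment, which rotations preserve; so the flow is linear on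
each torus. -/
theorem toricFlow_add (s t : ℝ) (z : C2) :
    toricFlow e (s + t) z = toricFlow e s (toricFlow e t z) := by
  rw [toricFlow, toricFlow, speed₀_congr (moment_toricFlow t z),
    speed₁_congr (moment_toricFlow t z), toricFlow, rot_rot, add_mul, add_mul]

theorem hasDerivAt_C2 {c : ℝ → C2} {c' : C2} {t : ℝ} (h₀ : HasDerivAt (fun t => c t 0) (c' 0) t)
    (h₁ : HasDerivAt (fun t => c t 1) (c' 1) t) : HasDerivAt c c' t := by
  rw [hasDerivAt_iff_hasFDerivAt, ← hasFDerivWithinAt_univ, hasFDerivWithinAt_piLp]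
  intro i
  fin_cases i
  · refine (hasDerivAt_iff_hasFDerivAt.1 h₀).hasFDerivWithinAt.congr_fderiv ?_
    ext; simp
  · refine (hasDerivAt_iff_hasFDerivAt.1 h₁).hasFDerivWithinAt.congr_fderiv ?_
    ext; simp

theorem hasDerivAt_toricFlow (z : C2) (t : ℝ) :
    HasDerivAt (fun τ => toricFlow e τ z) (toricField e (toricFlow e t z)) t := by
  have key : ∀ (a : ℝ) (w : ℂ), HasDerivAt
      (fun τ : ℝ => Complex.exp (((τ * a : ℝ) : ℂ) * Complex.I) * w)
      (Complex.I * (a * (Complex.exp (((t * a : ℝ) : ℂ) * Complex.I) * w))) t := by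
    intro a w
    have h1 : HasDerivAt (fun τ : ℝ => ((τ * a : ℝ) : ℂ)) ((1 * a : ℝ) : ℂ) t :=
      ((hasDerivAt_id t).mul_const a).ofReal_comp
    refine (((h1.mul_const Complex.I).cexp).mul_const w).congr_deriv ?_
    push_cast
    ring
  refine hasDerivAt_C2 ?_ ?_ <;>
  · rw [toricField, toricNormal_eq, speed₀_congr (moment_toricFlow t z),
      speed₁_congr (moment_toricFlow t z)]
    exact key _ _

theorem isFlowOn_toricFlow (hpos : ∀ s, 0 < e s) :
    IsFlowOn (toricBoundary (profileCurve e)) (toricField e) (toricFlow e) where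
  zero p _ := toricFlow_zero p
  mem p hp t := by
    rw [mem_toricBoundary hpos] at hp ⊢
    rw [toricGauge, moment_toricFlow]
    exact hp
  hasDerivAt p _ t := hasDerivAt_toricFlow p t

theorem contDiffAt_norm_toricGrad_inv (he : ContDiff ℝ ∞ e) (hpos : ∀ s, 0 < e s) {z : C2}
    (hz : z ≠ 0) : ContDiffAt ℝ ∞ (fun z => ‖toricGrad e z‖⁻¹) z :=
  ((contDiffAt_toricGrad he hz).norm ℝ (toricGrad_ne_zero hpos hz)).inv
    (norm_ne_zero_iff.2 (toricGrad_ne_zero hpos hz))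

theorem contDiffAt_speed₀ (he : ContDiff ℝ ∞ e) (hpos : ∀ s, 0 < e s) {z : C2} (hz : z ≠ 0) :
    ContDiffAt ℝ ∞ (speed₀ e) z :=
  (contDiffAt_norm_toricGrad_inv he hpos hz).mul
    (contDiffAt_const.mul ((ContDiff.slope₀ he).contDiffAt.comp z (contDiffAt_zratio hz)))

theorem contDiffAt_speed₁ (he : ContDiff ℝ ∞ e) (hpos : ∀ s, 0 < e s) {z : C2} (hz : z ≠ 0) :
    ContDiffAt ℝ ∞ (speed₁ e) z :=
  (contDiffAt_norm_toricGrad_inv he hpos hz).mul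
    (contDiffAt_const.mul ((ContDiff.slope₁ he).contDiffAt.comp z (contDiffAt_zratio hz)))

theorem contDiff_rot : ContDiff ℝ ∞ fun p : ℝ × ℝ × C2 => rot p.1 p.2.1 p.2.2 := by
  have h (i : Fin 2) : ContDiff ℝ ∞ (fun z : C2 => z i) :=
    ((EuclideanSpace.proj i : C2 →L[ℂ] ℂ).restrictScalars ℝ).contDiff
  have hof : ContDiff ℝ ∞ Complex.ofReal := Complex.ofRealCLM.contDiff
  have hexp : ContDiff ℝ ∞ fun a : ℝ => Complex.exp (a * Complex.I) :=
    (hof.mul contDiff_const).cexp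
  rw [contDiff_piLp]
  intro i
  fin_cases i
  · exact (hexp.comp contDiff_fst).mul ((h 0).comp (contDiff_snd.comp contDiff_snd))
  · exact (hexp.comp (contDiff_fst.comp contDiff_snd)).mul
      ((h 1).comp (contDiff_snd.comp contDiff_snd))

theorem contDiffAt_toricFlow (he : ContDiff ℝ ∞ e) (hpos : ∀ s, 0 < e s) {z : C2} (hz : z ≠ 0)
    (t : ℝ) : ContDiffAt ℝ ∞ (fun p : ℝ × C2 => toricFlow e p.1 p.2) (t, z) := by
  have h0 : ContDiffAt ℝ ∞ (fun p : ℝ × C2 => p.1 * speed₀ e p.2) (t, z) :=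
    contDiffAt_fst.mul ((contDiffAt_speed₀ he hpos hz).comp (t, z) contDiffAt_snd)
  have h1 : ContDiffAt ℝ ∞ (fun p : ℝ × C2 => p.1 * speed₁ e p.2) (t, z) :=
    contDiffAt_fst.mul ((contDiffAt_speed₁ he hpos hz).comp (t, z) contDiffAt_snd)
  exact contDiff_rot.contDiffAt.comp (t, z) (h0.prodMk (h1.prodMk contDiffAt_snd))

/-! ### The contact form -/

theorem inner_I_smul_I_smul (z w : C2) :
    inner ℝ (Complex.I • z) (Complex.I • w) = (inner ℝ z w : ℝ) := by
  simp only [inner_C2, PiLp.smul_apply, smul_eq_mul, Complex.I_mul_re, Complex.I_mul_im]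
  ring

theorem inner_I_smul_left (z w : C2) :
    inner ℝ (Complex.I • z) w = -(inner ℝ z (Complex.I • w) : ℝ) := by
  simp only [inner_C2, PiLp.smul_apply, smul_eq_mul, Complex.I_mul_re, Complex.I_mul_im]
  ring

theorem I_smul_I_smul (z : C2) : Complex.I • Complex.I • z = -z := by
  rw [smul_smul, Complex.I_mul_I, neg_one_smul]

/-- The Liouville form `½ ∑ⱼ (xⱼ dyⱼ - yⱼ dxⱼ)`. -/
noncomputable def liouville : C2 →L[ℝ] C2 →L[ℝ] ℝ :=
  LinearMap.toContinuousLinearMap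
    { toFun := fun z => (1 / 2 : ℝ) • innerSL ℝ (Complex.I • z)
      map_add' := fun z w => by ext v; simp
      map_smul' := fun c z => by
        ext v
        simp [smul_comm Complex.I c z]
        ring }

theorem liouville_apply (z v : C2) : liouville z v = 1 / 2 * inner ℝ (Complex.I • z) v := rfl

theorem liouville_sub (u v : C2) :
    liouville u v - liouville v u = inner ℝ (Complex.I • u) v := by
  rw [liouville_apply, liouville_apply, inner_I_smul_left v, real_inner_comm v]
  ring

/-- The contact form whose Reeb field is Hamiltonian for the toric gauge. -/
noncomputable def toricForm (e : ℝ → ℝ) (z : C2) : C2 →L[ℝ] ℝ := (toricGauge e z)⁻¹ • liouville z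

theorem ne_zero_of_mem_S3 {p : C2} (hp : p ∈ S3) : p ≠ 0 := by
  rintro rfl
  simp [S3] at hp

theorem contDiffAt_toricForm (he : ContDiff ℝ ∞ e) (hpos : ∀ s, 0 < e s) {z : C2} (hz : z ≠ 0) :
    ContDiffAt ℝ ∞ (toricForm e) z :=
  ((contDiffAt_toricGauge he hz).inv (toricGauge_pos hpos hz).ne').smul
    liouville.contDiff.contDiffAt

/-- With `Q` the gauge and `λ` the Liouville form, this is `d(Q⁻¹λ) = Q⁻¹ dλ - Q⁻² dQ ∧ λ`. -/
theorem dForm_toricForm (he : ContDiff ℝ ∞ e) (hpos : ∀ s, 0 < e s) {z : C2} (hz : z ≠ 0)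
    (u v : C2) : dForm (toricForm e) z u v = (toricGauge e z)⁻¹ * inner ℝ (Complex.I • u) v -
      (toricGauge e z ^ 2)⁻¹ * (inner ℝ (toricGrad e z) u * liouville z v -
        inner ℝ (toricGrad e z) v * liouville z u) := by
  have hi := (hasDerivAt_inv (toricGauge_pos hpos hz).ne').comp_hasFDerivAt z
    (hasFDerivAt_toricGauge he hz)
  have h : HasFDerivAt (toricForm e) _ z := hi.smul liouville.hasFDerivAt
  rw [dForm, h.fderiv, ← liouville_sub]
  simp
  ring

theorem liouville_eq_zero_of_mem_tightPlane {p v : C2} (hv : v ∈ tightPlane p) :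
    liouville p v = 0 := by
  have : inner ℝ p (Complex.I • v) = (0 : ℝ) := hv.2
  rw [liouville_apply, inner_I_smul_left, this]; simp

theorem isTightContactForm_toricForm (he : ContDiff ℝ ∞ e) (hpos : ∀ s, 0 < e s) :
    IsTightContactForm (toricForm e) where
  smooth := ⟨{0}ᶜ, isOpen_compl_singleton, fun _ hp => ne_zero_of_mem_S3 hp,
    fun _ hz => (contDiffAt_toricForm he hpos hz).contDiffWithinAt⟩
  kernel p hp v hv := by
    have hQ := (toricGauge_pos hpos (ne_zero_of_mem_S3 hp)).ne'
    have h : toricForm e p v = (toricGauge e p)⁻¹ * liouville p v := rfl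
    constructor
    · intro h0
      rw [h, mul_eq_zero, or_iff_right (inv_ne_zero hQ), liouville_apply, inner_I_smul_left] at h0
      refine ⟨hv, ?_⟩
      change inner ℝ p (Complex.I • v) = (0 : ℝ)
      linarith
    · intro h0
      rw [h, liouville_eq_zero_of_mem_tightPlane h0, mul_zero]
  contact p hp v hv hne := by
    have hp0 := ne_zero_of_mem_S3 hp
    -- The plane is complex, and `λ` vanishes on it, so `dα(v, iv) = Q⁻¹ |v|²`.
    have hw : Complex.I • v ∈ tightPlane p := by
      refine ⟨hv.2, ?_⟩
      change inner ℝ p (Complex.I • Complex.I • v) = (0 : ℝ)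
      rw [I_smul_I_smul, inner_neg_right, show inner ℝ p v = (0 : ℝ) from hv.1, neg_zero]
    refine ⟨_, hw, ?_⟩
    rw [dForm_toricForm he hpos hp0, liouville_eq_zero_of_mem_tightPlane hv,
      liouville_eq_zero_of_mem_tightPlane hw, real_inner_self_eq_norm_sq]
    have hQ := toricGauge_pos hpos hp0
    have : 0 < ‖Complex.I • v‖ := by
      rw [norm_smul, Complex.norm_I, one_mul]; exact norm_pos_iff.2 hne
    simp only [mul_zero, sub_zero]
    positivity

theorem inner_toricGrad_I_smul_toricGrad (z : C2) :
    inner ℝ (toricGrad e z) (Complex.I • toricGrad e z) = (0 : ℝ) :=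
  inner_diag_I_smul_diag _ _ _ _ z

/-- For `R = i∇Q`, Euler's identity gives `λ(R) = Q`, while `dQ(R) = 0`; the two remaining terms of
`dα(R, ·)` are multiples of `dQ` that cancel. -/
theorem isReebField_toricForm (he : ContDiff ℝ ∞ e) (hpos : ∀ s, 0 < e s) :
    IsReebField (toricForm e) fun z => Complex.I • toricGrad e z := by
  intro p hp
  have hp0 := ne_zero_of_mem_S3 hp
  have hQ := (toricGauge_pos hpos hp0).ne'
  have hl : liouville p (Complex.I • toricGrad e p) = toricGauge e p := by
    rw [liouville_apply, inner_I_smul_I_smul, real_inner_comm, inner_toricGrad_self hp0]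
    ring
  refine ⟨inner_self_I_smul_diag _ _ p, ?_, fun v _ => ?_⟩
  · change (toricGauge e p)⁻¹ * liouville p (Complex.I • toricGrad e p) = 1
    rw [hl, inv_mul_cancel₀ hQ]
  · rw [dForm_toricForm he hpos hp0, inner_toricGrad_I_smul_toricGrad, hl, I_smul_I_smul,
      inner_neg_left]
    field_simp
    ring

/-! ### The radial projection of the sphere -/

/-- The radial projection onto the hypersurface. -/
noncomputable def radialProj (e : ℝ → ℝ) (z : C2) : C2 := (√(toricGauge e z))⁻¹ • z

theorem contDiffAt_sqrt_toricGauge_inv (he : ContDiff ℝ ∞ e) (hpos : ∀ s, 0 < e s) {z : C2}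
    (hz : z ≠ 0) : ContDiffAt ℝ ∞ (fun z => (√(toricGauge e z))⁻¹) z :=
  ((contDiffAt_toricGauge he hz).sqrt (toricGauge_pos hpos hz).ne').inv
    (Real.sqrt_pos.2 (toricGauge_pos hpos hz)).ne'

/-- Apart from a radial term proportional to `dQ(v)`, the derivative is a scaling, so vectors
tangent to level sets of `Q` are only rescaled. -/
theorem hasFDerivAt_radialProj (he : ContDiff ℝ ∞ e) (hpos : ∀ s, 0 < e s) {z : C2} (hz : z ≠ 0) :
    ∃ c : ℝ, ∀ v, fderiv ℝ (radialProj e) z v =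
      (√(toricGauge e z))⁻¹ • v + (c * inner ℝ (toricGrad e z) v) • z := by
  have hQ := toricGauge_pos hpos hz
  have h1 := ((hasDerivAt_inv (Real.sqrt_pos.2 hQ).ne').comp _
    (Real.hasDerivAt_sqrt hQ.ne')).comp_hasFDerivAt z (hasFDerivAt_toricGauge he hz)
  have h : HasFDerivAt (radialProj e) _ z := h1.smul (hasFDerivAt_id z)
  refine ⟨-(√(toricGauge e z) ^ 2)⁻¹ * (1 / (2 * √(toricGauge e z))), fun v => ?_⟩
  rw [h.fderiv]
  rfl

theorem isDiffeoFromS3_radialProj (he : ContDiff ℝ ∞ e) (hpos : ∀ s, 0 < e s) :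
    IsDiffeoFromS3 (toricBoundary (profileCurve e)) (radialProj e) where
  smooth := ⟨{0}ᶜ, isOpen_compl_singleton, fun _ hp => ne_zero_of_mem_S3 hp, fun _ hz =>
    ((contDiffAt_sqrt_toricGauge_inv he hpos hz).smul contDiffAt_id).contDiffWithinAt⟩
  injOn p hp q hq h := by
    have hp1 : ‖p‖ = 1 := mem_sphere_zero_iff_norm.1 hp
    have hq1 : ‖q‖ = 1 := mem_sphere_zero_iff_norm.1 hq
    have h1 := congrArg norm h
    rw [radialProj, radialProj, norm_smul, norm_smul, hp1, hq1, mul_one, mul_one,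
      Real.norm_of_nonneg (by positivity), Real.norm_of_nonneg (by positivity)] at h1
    rw [radialProj, radialProj, ← h1] at h
    have := Real.sqrt_pos.2 (toricGauge_pos hpos (ne_zero_of_mem_S3 hp))
    exact smul_right_injective C2 (inv_ne_zero this.ne') h
  image := by
    ext z
    constructor
    · rintro ⟨p, hp, rfl⟩
      have hQ := toricGauge_pos hpos (ne_zero_of_mem_S3 hp)
      rw [mem_toricBoundary hpos, radialProj, toricGauge_smul, inv_pow, Real.sq_sqrt hQ.le,
        inv_mul_cancel₀ hQ.ne']
    · intro hz
      have hz0 := norm_pos_iff.2 (ne_zero_of_mem hpos hz)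
      refine ⟨‖z‖⁻¹ • z, ?_, ?_⟩
      · rw [S3, mem_sphere_zero_iff_norm, norm_smul, norm_inv, norm_norm, inv_mul_cancel₀ hz0.ne']
      · rw [radialProj, toricGauge_smul, (mem_toricBoundary hpos).1 hz, mul_one,
          Real.sqrt_sq (by positivity), inv_inv, smul_smul, mul_inv_cancel₀ hz0.ne', one_smul]
  immersion p hp v hv h := by
    obtain ⟨c, hc⟩ := hasFDerivAt_radialProj he hpos (ne_zero_of_mem_S3 hp)
    rw [hc] at h
    -- Pairing with `v` removes the radial term, as `v` is tangent to the sphere.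
    have h1 : inner ℝ ((√(toricGauge e p))⁻¹ • v + (c * inner ℝ (toricGrad e p) v) • p) v
        = (0 : ℝ) := by rw [h, inner_zero_left]
    rw [inner_add_left, real_inner_smul_left, real_inner_smul_left,
      show inner ℝ p v = (0 : ℝ) from hv, mul_zero, add_zero, mul_eq_zero] at h1
    have := Real.sqrt_pos.2 (toricGauge_pos hpos (ne_zero_of_mem_S3 hp))
    exact inner_self_eq_zero.1 (h1.resolve_left (inv_ne_zero this.ne'))

/-- The Reeb field `i∇Q` is tangent to level sets of `Q`, and `∇Q` is homogeneous of degree one, so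
radial projection carries it to a positive multiple of `X`. -/
theorem isEquivalentToTightReebFlow_profile (he : ContDiff ℝ ∞ e) (hpos : ∀ s, 0 < e s) :
    IsEquivalentToTightReebFlow (toricBoundary (profileCurve e)) (toricField e) := by
  refine ⟨toricForm e, _, radialProj e, isTightContactForm_toricForm he hpos,
    isReebField_toricForm he hpos, isDiffeoFromS3_radialProj he hpos, fun p hp => ?_⟩
  have hp0 := ne_zero_of_mem_S3 hp
  obtain ⟨c, hc⟩ := hasFDerivAt_radialProj he hpos hp0
  have hg := norm_pos_iff.2 (toricGrad_ne_zero hpos hp0)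
  have hQ := Real.sqrt_pos.2 (toricGauge_pos hpos hp0)
  refine ⟨(√(toricGauge e p))⁻¹ * ‖toricGrad e p‖, by positivity, ?_⟩
  rw [hc, inner_toricGrad_I_smul_toricGrad, mul_zero, zero_smul, add_zero, toricField, toricNormal,
    radialProj, toricGrad_smul (inv_ne_zero hQ.ne'), norm_smul, Real.norm_of_nonneg (by positivity),
    smul_comm _ Complex.I, smul_comm _ Complex.I]
  congr 1
  rw [smul_smul, smul_smul]
  congr 1
  field_simp

/-! ### Semicircles -/

/-- The point of the segment `x₀ + x₁ = 1` with first coordinate `σ`. -/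
noncomputable def simplexPt (σ : ℝ) : Plane := !₂[σ, 1 - σ]

@[simp] theorem simplexPt_zero (σ : ℝ) : simplexPt σ 0 = σ := rfl
@[simp] theorem simplexPt_one (σ : ℝ) : simplexPt σ 1 = 1 - σ := rfl

/-- The point at angle `φ` of the circle about `simplexPt σ` of radius `κ * ‖simplexPt σ‖`; the
angle is measured from the outward radial direction. -/
noncomputable def arcPt (σ κ φ : ℝ) : Plane :=
  !₂[σ + κ * (Real.cos φ * σ - Real.sin φ * (1 - σ)),
    (1 - σ) + κ * (Real.cos φ * (1 - σ) + Real.sin φ * σ)]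

theorem arcPt_zero (σ κ φ : ℝ) :
    arcPt σ κ φ 0 = σ + κ * (Real.cos φ * σ - Real.sin φ * (1 - σ)) := rfl
theorem arcPt_one (σ κ φ : ℝ) :
    arcPt σ κ φ 1 = (1 - σ) + κ * (Real.cos φ * (1 - σ) + Real.sin φ * σ) := rfl

theorem continuous_arcPt (σ κ : ℝ) : Continuous (arcPt σ κ) := by
  unfold arcPt; fun_prop

theorem simplex_norm_pos (σ : ℝ) : 0 < σ ^ 2 + (1 - σ) ^ 2 := by nlinarith [sq_nonneg (2 * σ - 1)]

theorem norm_simplexPt_sq (σ : ℝ) : ‖simplexPt σ‖ ^ 2 = σ ^ 2 + (1 - σ) ^ 2 := by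
  rw [EuclideanSpace.norm_sq_eq, Fin.sum_univ_two]; simp

theorem simplexPt_ne_zero (σ : ℝ) : simplexPt σ ≠ 0 := by
  intro h
  have := norm_simplexPt_sq σ
  rw [h, norm_zero] at this
  linarith [simplex_norm_pos σ]

theorem inner_plane (x y : Plane) : inner ℝ x y = x 0 * y 0 + x 1 * y 1 := by
  rw [PiLp.inner_apply, Fin.sum_univ_two]; simp [mul_comm]

theorem dist_eq_iff_plane {x y : Plane} {r : ℝ} (hr : 0 ≤ r) :
    dist x y = r ↔ (x 0 - y 0) ^ 2 + (x 1 - y 1) ^ 2 = r ^ 2 := by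
  rw [← sq_eq_sq₀ dist_nonneg hr, dist_eq_norm, EuclideanSpace.norm_sq_eq, Fin.sum_univ_two]
  simp

/-- Polar coordinates on the right half plane. -/
theorem exists_cos_sin_of_nonneg {a b : ℝ} (ha : 0 ≤ a) (h : a ^ 2 + b ^ 2 = 1) :
    ∃ φ ∈ Set.Icc (-(Real.pi / 2)) (Real.pi / 2), Real.cos φ = a ∧ Real.sin φ = b := by
  refine ⟨Real.arcsin b, Real.arcsin_mem_Icc b, ?_, Real.sin_arcsin ?_ ?_⟩
  · rw [Real.cos_arcsin, ← h, add_sub_cancel_right, Real.sqrt_sq ha]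
  · nlinarith
  · nlinarith

theorem outerSemicircle_eq_image (σ : ℝ) {κ : ℝ} (hκ : 0 < κ) :
    outerSemicircle (simplexPt σ) (κ * ‖simplexPt σ‖) =
      arcPt σ κ '' Set.Icc (-(Real.pi / 2)) (Real.pi / 2) := by
  have hN := simplex_norm_pos σ
  have hr : 0 ≤ κ * ‖simplexPt σ‖ := by positivity
  ext x
  rw [outerSemicircle, Set.mem_ofPred_eq, dist_eq_iff_plane hr, inner_plane, mul_pow,
    norm_simplexPt_sq]
  simp only [PiLp.sub_apply, simplexPt_zero, simplexPt_one]
  constructor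
  · rintro ⟨h1, h2⟩
    -- With `c = (σ, 1 - σ)`, these are the coordinates of `x - c` in the orthonormal frame along
    -- `c` and its quarter turn, divided by the radius `κ|c|`.
    obtain ⟨φ, hφ, hc, hs⟩ := exists_cos_sin_of_nonneg
      (a := ((x 0 - σ) * σ + (x 1 - (1 - σ)) * (1 - σ)) / (κ * (σ ^ 2 + (1 - σ) ^ 2)))
      (b := (-(x 0 - σ) * (1 - σ) + (x 1 - (1 - σ)) * σ) / (κ * (σ ^ 2 + (1 - σ) ^ 2)))
      (by positivity) (by
        rw [div_pow, div_pow, ← add_div, div_eq_one_iff_eq (by positivity)]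
        linear_combination (σ ^ 2 + (1 - σ) ^ 2) * h1)
    have hN' := hN.ne'
    refine ⟨φ, hφ, plane_ext ?_ ?_⟩
    · rw [arcPt_zero, hc, hs]
      field_simp
      ring
    · rw [arcPt_one, hc, hs]
      field_simp
      ring
  · rintro ⟨φ, hφ, rfl⟩
    have hc := Real.cos_nonneg_of_mem_Icc hφ
    rw [arcPt_zero, arcPt_one]
    constructor
    · linear_combination (κ ^ 2 * (σ ^ 2 + (1 - σ) ^ 2)) * Real.sin_sq_add_cos_sq φ
    · have : 0 ≤ κ * Real.cos φ * (σ ^ 2 + (1 - σ) ^ 2) := by positivity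
      linarith

/-! ### Semicircles as radial graphs -/

section Arc

variable {σ κ φ : ℝ}

theorem arcPt_add (σ κ φ : ℝ) : arcPt σ κ φ 0 + arcPt σ κ φ 1 =
    1 + κ * (Real.cos φ + (2 * σ - 1) * Real.sin φ) := by
  rw [arcPt_zero, arcPt_one]; ring

theorem arcPt_add_ge (hσ : σ ∈ Set.Ioo (0 : ℝ) 1) (hκ : 0 < κ) (hκ' : κ ≤ 1 / 4) :
    1 / 2 ≤ arcPt σ κ φ 0 + arcPt σ κ φ 1 := by
  rw [arcPt_add]
  have h1 := Real.neg_one_le_cos φ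
  have h2 : -1 ≤ (2 * σ - 1) * Real.sin φ := by
    refine neg_le_of_abs_le ?_
    rw [abs_mul]
    exact mul_le_one₀ (abs_le.2 ⟨by linarith [hσ.1], by linarith [hσ.2]⟩) (abs_nonneg _)
      (Real.abs_sin_le_one φ)
  nlinarith

/-- Radial displacement leaves the ratio unchanged, so only the sine component moves it. Arcs with
centres more than `4 * κ` apart therefore span disjoint angular sectors. -/
theorem abs_arcPt_ratio_sub_le (hσ : σ ∈ Set.Ioo (0 : ℝ) 1) (hκ : 0 < κ) (hκ' : κ ≤ 1 / 4) :
    |arcPt σ κ φ 0 / (arcPt σ κ φ 0 + arcPt σ κ φ 1) - σ| ≤ 2 * κ := by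
  have hm := arcPt_add_ge (φ := φ) hσ hκ hκ'
  have hm0 : 0 < arcPt σ κ φ 0 + arcPt σ κ φ 1 := by linarith
  have h : arcPt σ κ φ 0 / (arcPt σ κ φ 0 + arcPt σ κ φ 1) - σ =
      -(κ * (Real.sin φ * (σ ^ 2 + (1 - σ) ^ 2))) / (arcPt σ κ φ 0 + arcPt σ κ φ 1) := by
    rw [eq_div_iff hm0.ne', sub_mul, div_mul_cancel₀ _ hm0.ne', arcPt_zero, arcPt_one]
    ring
  rw [h, abs_div, abs_of_pos hm0, div_le_iff₀ hm0, abs_neg, abs_mul, abs_of_pos hκ, abs_mul,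
    abs_of_pos (simplex_norm_pos σ)]
  have h1 : |Real.sin φ| * (σ ^ 2 + (1 - σ) ^ 2) ≤ 1 :=
    mul_le_one₀ (Real.abs_sin_le_one φ) (simplex_norm_pos σ).le (by nlinarith [hσ.1, hσ.2])
  nlinarith

theorem arcPt_pos (hσ : σ ∈ Set.Ioo (0 : ℝ) 1) (hκ : 0 < κ) (hκ' : κ ≤ 1 / 4)
    (h₀ : 2 * κ < σ) (h₁ : 2 * κ < 1 - σ) : 0 < arcPt σ κ φ 0 ∧ 0 < arcPt σ κ φ 1 := by
  have hm := arcPt_add_ge (φ := φ) hσ hκ hκ'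
  have hm0 : 0 < arcPt σ κ φ 0 + arcPt σ κ φ 1 := by linarith
  obtain ⟨ha, hb⟩ := abs_le.1 (abs_arcPt_ratio_sub_le (φ := φ) hσ hκ hκ')
  have h2 : 0 < arcPt σ κ φ 0 / (arcPt σ κ φ 0 + arcPt σ κ φ 1) := by linarith
  have h3 : arcPt σ κ φ 0 / (arcPt σ κ φ 0 + arcPt σ κ φ 1) < 1 := by linarith
  rw [div_pos_iff_of_pos_right hm0] at h2
  rw [div_lt_one hm0] at h3
  exact ⟨h2, by linarith⟩

/-- The discriminant of the quadratic equation for the intersection of the circle with a ray. -/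
noncomputable def arcDisc (σ κ s : ℝ) : ℝ := (s * σ + (1 - s) * (1 - σ)) ^ 2 -
  (s ^ 2 + (1 - s) ^ 2) * ((σ ^ 2 + (1 - σ) ^ 2) * (1 - κ ^ 2))

/-- The profile of the outer branch of the circle. -/
noncomputable def arcProfile (σ κ s : ℝ) : ℝ :=
  (s ^ 2 + (1 - s) ^ 2) / (s * σ + (1 - s) * (1 - σ) + √(arcDisc σ κ s))

/-- On the ray through `v = (s, 1 - s)`, the circle is met at the multiples `m` with `|v|²m² - 2⟨v,
c⟩m + |c|²(1 - κ²) = 0`; the outer semicircle consists of larger roots. -/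
theorem sqrt_arcDisc_eq (hσ : σ ∈ Set.Ioo (0 : ℝ) 1) (hκ : 0 < κ) (hκ' : κ ≤ 1 / 4)
    (hφ : φ ∈ Set.Icc (-(Real.pi / 2)) (Real.pi / 2)) {s : ℝ}
    (hs : arcPt σ κ φ 0 / (arcPt σ κ φ 0 + arcPt σ κ φ 1) = s) :
    0 < arcDisc σ κ s ∧ s * σ + (1 - s) * (1 - σ) + √(arcDisc σ κ s) =
      (arcPt σ κ φ 0 + arcPt σ κ φ 1) * (s ^ 2 + (1 - s) ^ 2) := by
  have hm := arcPt_add_ge (φ := φ) hσ hκ hκ'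
  set m := arcPt σ κ φ 0 + arcPt σ κ φ 1 with hmdef
  have hm0 : 0 < m := by linarith
  have h0 : arcPt σ κ φ 0 = s * m := (div_eq_iff hm0.ne').1 hs
  have h1 : arcPt σ κ φ 1 = (1 - s) * m := by linarith
  rw [arcPt_zero] at h0
  rw [arcPt_one] at h1
  have hN := simplex_norm_pos σ
  have hc := Real.cos_nonneg_of_mem_Icc hφ
  have hcs := Real.sin_sq_add_cos_sq φ
  have e0 : s * m - σ = κ * (Real.cos φ * σ - Real.sin φ * (1 - σ)) := by linarith
  have e1 : (1 - s) * m - (1 - σ) = κ * (Real.cos φ * (1 - σ) + Real.sin φ * σ) := by linarith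
  have hq : (s * m - σ) ^ 2 + ((1 - s) * m - (1 - σ)) ^ 2 = κ ^ 2 * (σ ^ 2 + (1 - σ) ^ 2) := by
    rw [e0, e1]; linear_combination (κ ^ 2 * (σ ^ 2 + (1 - σ) ^ 2)) * hcs
  have hr : (s * m - σ) * σ + ((1 - s) * m - (1 - σ)) * (1 - σ) =
      κ * Real.cos φ * (σ ^ 2 + (1 - σ) ^ 2) := by
    rw [e0, e1]; ring
  -- The term `κ²|c|²` keeps this positive even at the ends, where the cosine vanishes; hence the
  -- square root is smooth past the ends.
  have hD : 0 < m * (s ^ 2 + (1 - s) ^ 2) - (s * σ + (1 - s) * (1 - σ)) := by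
    have : 0 < m * (m * (s ^ 2 + (1 - s) ^ 2) - (s * σ + (1 - s) * (1 - σ))) := by
      have h2 : m * (m * (s ^ 2 + (1 - s) ^ 2) - (s * σ + (1 - s) * (1 - σ))) =
          κ ^ 2 * (σ ^ 2 + (1 - σ) ^ 2) + κ * Real.cos φ * (σ ^ 2 + (1 - σ) ^ 2) := by
        linear_combination hq + hr
      rw [h2]; positivity
    exact pos_of_mul_pos_right this hm0.le
  have hsq : arcDisc σ κ s =
      (m * (s ^ 2 + (1 - s) ^ 2) - (s * σ + (1 - s) * (1 - σ))) ^ 2 := by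
    rw [arcDisc]
    linear_combination -(s ^ 2 + (1 - s) ^ 2) * hq
  rw [hsq, Real.sqrt_sq hD.le]
  exact ⟨by positivity, by ring⟩

theorem arcProfile_eq (hσ : σ ∈ Set.Ioo (0 : ℝ) 1) (hκ : 0 < κ) (hκ' : κ ≤ 1 / 4)
    (hφ : φ ∈ Set.Icc (-(Real.pi / 2)) (Real.pi / 2)) {s : ℝ}
    (hs : arcPt σ κ φ 0 / (arcPt σ κ φ 0 + arcPt σ κ φ 1) = s) :
    arcProfile σ κ s = (arcPt σ κ φ 0 + arcPt σ κ φ 1)⁻¹ := by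
  have hm := arcPt_add_ge (φ := φ) hσ hκ hκ'
  rw [arcProfile, (sqrt_arcDisc_eq hσ hκ hκ' hφ hs).2,
    div_mul_cancel_right₀ (simplex_norm_pos s).ne']

end Arc

/-- The ratios `x₀ / (x₀ + x₁)` on a semicircle. -/
noncomputable def arcShadow (σ κ : ℝ) : Set ℝ :=
  (fun φ => arcPt σ κ φ 0 / (arcPt σ κ φ 0 + arcPt σ κ φ 1)) ''
    Set.Icc (-(Real.pi / 2)) (Real.pi / 2)

theorem isClosed_arcShadow {σ κ : ℝ} (hσ : σ ∈ Set.Ioo (0 : ℝ) 1) (hκ : 0 < κ) (hκ' : κ ≤ 1 / 4) :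
    IsClosed (arcShadow σ κ) := by
  refine (isCompact_Icc.image ?_).isClosed
  have h := continuous_arcPt σ κ
  refine Continuous.div (by fun_prop) (by fun_prop) fun φ => ?_
  linarith [arcPt_add_ge (φ := φ) hσ hκ hκ']

/-- Disjoint semicircles about points of the simplex lie on a common level set of a gauge. -/
theorem exists_profile {ι : Type*} [Finite ι] {σ : ι → ℝ} {κ : ℝ}
    (hσ : ∀ i, σ i ∈ Set.Ioo (0 : ℝ) 1) (hκ : 0 < κ) (hκ' : κ ≤ 1 / 4)
    (hdisj : Pairwise fun i j => 4 * κ < |σ i - σ j|) :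
    ∃ e : ℝ → ℝ, ContDiff ℝ ∞ e ∧ (∀ s, 0 < e s) ∧
      ∀ i, ∀ φ ∈ Set.Icc (-(Real.pi / 2)) (Real.pi / 2), gauge e (arcPt (σ i) κ φ) = 1 := by
  have hshadow : ∀ {i s}, s ∈ arcShadow (σ i) κ → |s - σ i| ≤ 2 * κ := by
    rintro i _ ⟨φ, -, rfl⟩
    exact abs_arcPt_ratio_sub_le (hσ i) hκ hκ'
  have hunique : ∀ {i j s}, s ∈ arcShadow (σ i) κ → s ∈ arcShadow (σ j) κ → i = j := by
    intro i j s hi hj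
    by_contra hne
    have h1 := hdisj hne
    have h2 := abs_sub_le (σ i) s (σ j)
    rw [abs_sub_comm (σ i) s] at h2
    linarith [hshadow hi, hshadow hj]
  -- Positivity, together with the prescribed value over each shadow, is a convex condition, so
  -- local smooth solutions can be glued.
  let t : ℝ → Set ℝ := fun s => {y | 0 < y ∧
    ∀ i, s ∈ arcShadow (σ i) κ → y = arcProfile (σ i) κ s}
  have ht : ∀ s, Convex ℝ (t s) := by
    rintro s y ⟨hy, hy'⟩ w ⟨hw, hw'⟩ a b ha hb hab
    refine ⟨(convex_Ioi (0 : ℝ)) hy hw ha hb hab, fun i hi => ?_⟩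
    rw [hy' i hi, hw' i hi, ← add_smul, hab, one_smul]
  have hloc : ∀ s, ∃ U ∈ 𝓝 s, ∃ g : ℝ → ℝ, ContMDiffOn 𝓘(ℝ, ℝ) 𝓘(ℝ, ℝ) ∞ g U ∧
      ∀ y ∈ U, g y ∈ t y := by
    intro s
    by_cases hs : ∃ i, s ∈ arcShadow (σ i) κ
    · obtain ⟨i, hi⟩ := hs
      have hV : IsOpen (⋂ j : {j // j ≠ i}, (arcShadow (σ j) κ)ᶜ) :=
        isOpen_iInter_of_finite fun j => (isClosed_arcShadow (hσ j) hκ hκ').isOpen_compl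
      have hcd : Continuous (arcDisc (σ i) κ) := by unfold arcDisc; fun_prop
      have hcs : Continuous fun s => s * σ i + (1 - s) * (1 - σ i) + √(arcDisc (σ i) κ s) := by
        fun_prop
      obtain ⟨φ, hφ, hφs⟩ := id hi
      have hval := sqrt_arcDisc_eq (hσ i) hκ hκ' hφ hφs
      -- Away from the other shadows, and where the discriminant and denominator stay positive, the
      -- profile of the arc continues smoothly beyond its own shadow.
      refine ⟨(⋂ j : {j // j ≠ i}, (arcShadow (σ j) κ)ᶜ) ∩ ({s | 0 < arcDisc (σ i) κ s} ∩
        {s | 0 < s * σ i + (1 - s) * (1 - σ i) + √(arcDisc (σ i) κ s)}), ?_,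
        arcProfile (σ i) κ, ?_, ?_⟩
      · refine (hV.inter ((isOpen_lt continuous_const hcd).inter
          (isOpen_lt continuous_const hcs))).mem_nhds ⟨?_, hval.1, ?_⟩
        · exact Set.mem_iInter.2 fun j hj => j.2 (hunique hj hi)
        · rw [Set.mem_ofPred_eq, hval.2]
          have := arcPt_add_ge (φ := φ) (hσ i) hκ hκ'
          exact mul_pos (by linarith) (simplex_norm_pos s)
      · rw [contMDiffOn_iff_contDiffOn]
        rintro y ⟨-, hy, hy'⟩
        refine ContDiffAt.contDiffWithinAt ?_
        have hd : ContDiffAt ℝ ∞ (arcDisc (σ i) κ) y := by unfold arcDisc; fun_prop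
        refine ContDiffAt.div (by fun_prop) (ContDiffAt.add (by fun_prop) (hd.sqrt ?_)) ?_
        · exact (ne_of_gt hy)
        · exact (ne_of_gt hy')
      · rintro y ⟨hy, -, hy'⟩
        refine ⟨div_pos (simplex_norm_pos y) hy', fun j hj => ?_⟩
        by_contra h
        exact Set.mem_iInter.1 hy ⟨j, fun hji => h (by rw [hji])⟩ hj
    · refine ⟨⋂ j, (arcShadow (σ j) κ)ᶜ, ?_, fun _ => 1, contMDiffOn_const, fun y hy =>
        ⟨one_pos, fun i hi => (Set.mem_iInter.1 hy i hi).elim⟩⟩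
      refine (isOpen_iInter_of_finite fun j =>
        (isClosed_arcShadow (hσ j) hκ hκ').isOpen_compl).mem_nhds ?_
      exact Set.mem_iInter.2 fun j hj => hs ⟨j, hj⟩
  obtain ⟨e, he⟩ := exists_contMDiffMap_forall_mem_convex_of_local 𝓘(ℝ, ℝ) (n := ⊤) ht hloc
  refine ⟨e, e.contMDiff.contDiff, fun s => (he s).1, fun i φ hφ => ?_⟩
  have hm := arcPt_add_ge (φ := φ) (hσ i) hκ hκ'
  rw [gauge, (he _).2 i ⟨φ, hφ, rfl⟩, arcProfile_eq (hσ i) hκ hκ' hφ rfl, mul_inv_cancel₀]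
  linarith

/-! ### Directions of the flow along a semicircle -/

theorem hasDerivAt_gauge_comp (he : ContDiff ℝ ∞ e) {x y : ℝ → ℝ} {x' y' t : ℝ}
    (hx : HasDerivAt x x' t) (hy : HasDerivAt y y' t) (hm : x t + y t ≠ 0) :
    HasDerivAt (fun t => (x t + y t) * e (x t / (x t + y t)))
      (slope₀ e (x t / (x t + y t)) * x' + slope₁ e (x t / (x t + y t)) * y') t := by
  have hd := (he.differentiable (by simp) (x t / (x t + y t))).hasDerivAt
  have hr := hx.fun_div (hx.fun_add hy) hm
  refine ((hx.fun_add hy).mul (hd.comp t hr)).congr_deriv ?_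
  simp only [slope₀, slope₁, Function.comp]
  field_simp
  ring

variable {σ κ φ : ℝ}

/-- Along an arc in a level set of the gauge, the gradient is orthogonal to the tangent. -/
theorem slope_orthogonal (he : ContDiff ℝ ∞ e) (hσ : σ ∈ Set.Ioo (0 : ℝ) 1) (hκ : 0 < κ)
    (hκ' : κ ≤ 1 / 4)
    (h : ∀ φ ∈ Set.Icc (-(Real.pi / 2)) (Real.pi / 2), gauge e (arcPt σ κ φ) = 1)
    (hφ : φ ∈ Set.Icc (-(Real.pi / 2)) (Real.pi / 2)) :
    slope₀ e (arcPt σ κ φ 0 / (arcPt σ κ φ 0 + arcPt σ κ φ 1)) *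
        (κ * (-Real.sin φ * σ - Real.cos φ * (1 - σ))) +
      slope₁ e (arcPt σ κ φ 0 / (arcPt σ κ φ 0 + arcPt σ κ φ 1)) *
        (κ * (-Real.sin φ * (1 - σ) + Real.cos φ * σ)) = 0 := by
  have hm := arcPt_add_ge (φ := φ) hσ hκ hκ'
  have hc := Real.hasDerivAt_cos φ
  have hs := Real.hasDerivAt_sin φ
  have hd := hasDerivAt_gauge_comp he (x := fun φ => arcPt σ κ φ 0) (y := fun φ => arcPt σ κ φ 1)
    (t := φ) ((((hc.mul_const σ).sub (hs.mul_const (1 - σ))).const_mul κ).const_add σ)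
    ((((hc.mul_const (1 - σ)).add (hs.mul_const σ)).const_mul κ).const_add (1 - σ)) (by linarith)
  -- The gauge is known to be `1` only on the closed arc, so derivatives are compared within the
  -- interval; they are one-sided at its ends.
  have h1 := hd.hasDerivWithinAt (s := Set.Icc (-(Real.pi / 2)) (Real.pi / 2))
  have h2 : HasDerivWithinAt (fun φ => (arcPt σ κ φ 0 + arcPt σ κ φ 1) *
      e (arcPt σ κ φ 0 / (arcPt σ κ φ 0 + arcPt σ κ φ 1))) 0
      (Set.Icc (-(Real.pi / 2)) (Real.pi / 2)) φ :=
    (hasDerivWithinAt_const φ _ (1 : ℝ)).congr (fun ψ hψ => h ψ hψ) (h φ hφ)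
  have hu : UniqueDiffWithinAt ℝ (Set.Icc (-(Real.pi / 2)) (Real.pi / 2)) φ :=
    uniqueDiffOn_Icc (by linarith [Real.pi_pos]) φ hφ
  exact hu.eq_deriv _ h1 h2

/-- The normal at angle `φ` is `c` turned by `φ`, so `φ` is taken to be the angle from `c` to `(a,
b)`; the sign hypothesis puts it in `[-π/2, π/2]`. The factor is nonzero because Euler's identity
prevents both slopes from vanishing. -/
theorem exists_arc_direction_of_nonneg (he : ContDiff ℝ ∞ e) (hpos : ∀ s, 0 < e s)
    (hσ : σ ∈ Set.Ioo (0 : ℝ) 1) (hκ : 0 < κ) (hκ' : κ ≤ 1 / 4)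
    (h : ∀ φ ∈ Set.Icc (-(Real.pi / 2)) (Real.pi / 2), gauge e (arcPt σ κ φ) = 1)
    {a b : ℝ} (hab : 0 < a ^ 2 + b ^ 2) (hnn : 0 ≤ a * σ + b * (1 - σ)) :
    ∃ φ ∈ Set.Icc (-(Real.pi / 2)) (Real.pi / 2), ∃ l : ℝ, l ≠ 0 ∧
      slope₀ e (arcPt σ κ φ 0 / (arcPt σ κ φ 0 + arcPt σ κ φ 1)) = l * a ∧
      slope₁ e (arcPt σ κ φ 0 / (arcPt σ κ φ 0 + arcPt σ κ φ 1)) = l * b := by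
  have hN := simplex_norm_pos σ
  set r := √((a ^ 2 + b ^ 2) * (σ ^ 2 + (1 - σ) ^ 2)) with hr
  have hr0 : 0 < r := Real.sqrt_pos.2 (by positivity)
  have hr2 : r ^ 2 = (a ^ 2 + b ^ 2) * (σ ^ 2 + (1 - σ) ^ 2) := Real.sq_sqrt (by positivity)
  obtain ⟨φ, hφ, hc, hs⟩ := exists_cos_sin_of_nonneg (a := (a * σ + b * (1 - σ)) / r)
    (b := (-a * (1 - σ) + b * σ) / r) (by positivity) (by
      rw [div_pow, div_pow, ← add_div, div_eq_one_iff_eq (by positivity), hr2]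
      ring)
  refine ⟨φ, hφ, ?_⟩
  have ho := slope_orthogonal he hσ hκ hκ' h hφ
  have hE := slope_euler (e := e) (arcPt σ κ φ 0 / (arcPt σ κ φ 0 + arcPt σ κ φ 1))
  have hp := hpos (arcPt σ κ φ 0 / (arcPt σ κ φ 0 + arcPt σ κ φ 1))
  rw [hc, hs] at ho
  generalize arcPt σ κ φ 0 / (arcPt σ κ φ 0 + arcPt σ κ φ 1) = s at *
  have hx : slope₀ e s * b = slope₁ e s * a := by
    have h1 : κ * (σ ^ 2 + (1 - σ) ^ 2) / r * (slope₁ e s * a - slope₀ e s * b) = 0 := by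
      rw [← ho]; field_simp; ring
    have := (mul_eq_zero.1 h1).resolve_left (by positivity)
    linarith
  have hl₀ : slope₀ e s = (slope₀ e s * a + slope₁ e s * b) / (a ^ 2 + b ^ 2) * a := by
    field_simp
    linear_combination b * hx
  have hl₁ : slope₁ e s = (slope₀ e s * a + slope₁ e s * b) / (a ^ 2 + b ^ 2) * b := by
    field_simp
    linear_combination -a * hx
  refine ⟨_, fun h0 => ?_, hl₀, hl₁⟩
  rw [h0, zero_mul] at hl₀ hl₁
  rw [hl₀, hl₁] at hE
  linarith

/-- One of `(a, b)` and `(-a, -b)` makes a nonnegative inner product with the centre: a half circle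
of normals covers `ℝP¹`. -/
theorem exists_arc_direction (he : ContDiff ℝ ∞ e) (hpos : ∀ s, 0 < e s)
    (hσ : σ ∈ Set.Ioo (0 : ℝ) 1) (hκ : 0 < κ) (hκ' : κ ≤ 1 / 4)
    (h : ∀ φ ∈ Set.Icc (-(Real.pi / 2)) (Real.pi / 2), gauge e (arcPt σ κ φ) = 1)
    {a b : ℝ} (hab : 0 < a ^ 2 + b ^ 2) :
    ∃ φ ∈ Set.Icc (-(Real.pi / 2)) (Real.pi / 2), ∃ l : ℝ, l ≠ 0 ∧
      slope₀ e (arcPt σ κ φ 0 / (arcPt σ κ φ 0 + arcPt σ κ φ 1)) = l * a ∧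
      slope₁ e (arcPt σ κ φ 0 / (arcPt σ κ φ 0 + arcPt σ κ φ 1)) = l * b := by
  rcases le_total 0 (a * σ + b * (1 - σ)) with hnn | hnn
  · exact exists_arc_direction_of_nonneg he hpos hσ hκ hκ' h hab hnn
  · obtain ⟨φ, hφ, l, hl, h0, h1⟩ := exists_arc_direction_of_nonneg he hpos hσ hκ hκ' h
      (a := -a) (b := -b) (by simpa using hab) (by linarith)
    exact ⟨φ, hφ, -l, neg_ne_zero.2 hl, by rw [h0]; ring, by rw [h1]; ring⟩

/-- A point of the torus over `x`. -/
noncomputable def basePt (x : Plane) : C2 :=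
  !₂[((√(x 0 / Real.pi) : ℝ) : ℂ), ((√(x 1 / Real.pi) : ℝ) : ℂ)]

theorem continuous_basePt : Continuous basePt := by unfold basePt; fun_prop

theorem moment_basePt {x : Plane} (hx : x ∈ quadrant) : moment (basePt x) = x := by
  have hπ := Real.pi_pos
  refine plane_ext ?_ ?_
  · rw [moment_zero_apply, basePt]
    simp [abs_of_nonneg, Real.sqrt_nonneg, Real.sq_sqrt (div_nonneg hx.1 hπ.le)]
    field_simp
  · rw [moment_one_apply, basePt]
    simp [abs_of_nonneg, Real.sqrt_nonneg, Real.sq_sqrt (div_nonneg hx.2 hπ.le)]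
    field_simp

theorem sweepsAllDirections_toricField (he : ContDiff ℝ ∞ e) (hpos : ∀ s, 0 < e s)
    (hσ : σ ∈ Set.Ioo (0 : ℝ) 1) (hκ : 0 < κ) (hκ' : κ ≤ 1 / 4)
    (hq : ∀ φ, arcPt σ κ φ ∈ quadrant)
    (h : ∀ φ ∈ Set.Icc (-(Real.pi / 2)) (Real.pi / 2), gauge e (arcPt σ κ φ) = 1) :
    SweepsAllDirections (toricField e)
      (outerSemicircle (simplexPt σ) (κ * ‖simplexPt σ‖)) := by
  intro w hw
  have hw' : 0 < w 0 ^ 2 + w 1 ^ 2 := by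
    have : 0 < ‖w‖ ^ 2 := by positivity
    simpa [EuclideanSpace.norm_sq_eq, Fin.sum_univ_two] using this
  obtain ⟨φ, hφ, l, hl, h0, h1⟩ := exists_arc_direction he hpos hσ hκ hκ' h hw'
  have hm := moment_basePt (hq φ)
  have hx : basePt (arcPt σ κ φ) ≠ 0 := by
    intro h0
    rw [h0] at hm
    have := arcPt_add_ge (φ := φ) hσ hκ hκ'
    rw [← hm] at this
    norm_num [moment] at this
  have hg := norm_pos_iff.2 (toricGrad_ne_zero hpos hx)
  refine ⟨arcPt σ κ φ, ?_, ‖toricGrad e (basePt (arcPt σ κ φ))‖⁻¹ * (2 * Real.pi * l), ?_, ?_⟩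
  · rw [outerSemicircle_eq_image σ hκ]
    exact ⟨φ, hφ, rfl⟩
  · have := Real.pi_ne_zero
    positivity
  · intro z hz
    rw [toricField, toricNormal_eq, speed₀_congr (hz.trans hm.symm),
      speed₁_congr (hz.trans hm.symm), speed₀, speed₁, ← moment_ratio, hm, h0, h1]
    refine C2_ext ?_ ?_
    · simp; ring
    · simp; ring

/-- The family of tori over a semicircle. -/
noncomputable def torusFamily (σ κ : ℝ) (p : ℝ × ℝ × ℝ) : C2 :=
  rot p.1 p.2.1 (basePt (arcPt σ κ
    (Set.projIcc (-(Real.pi / 2)) (Real.pi / 2) (by linarith [Real.pi_pos]) p.2.2)))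

theorem continuous_torusFamily (σ κ : ℝ) : Continuous (torusFamily σ κ) := by
  have h1 : Continuous fun p : ℝ × ℝ × ℝ => basePt (arcPt σ κ
      (Set.projIcc (-(Real.pi / 2)) (Real.pi / 2) (by linarith [Real.pi_pos]) p.2.2)) :=
    continuous_basePt.comp ((continuous_arcPt σ κ).comp (continuous_subtype_val.comp
      (continuous_projIcc.comp (continuous_snd.comp continuous_snd))))
  exact contDiff_rot.continuous.comp
    (continuous_fst.prodMk ((continuous_fst.comp continuous_snd).prodMk h1))

theorem rot_add_two_pi_left (a b : ℝ) (z : C2) : rot (a + 2 * Real.pi) b z = rot a b z :=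
  C2_ext (by simp [add_mul, Complex.exp_add, Complex.exp_two_pi_mul_I]) rfl

theorem rot_add_two_pi_right (a b : ℝ) (z : C2) : rot a (b + 2 * Real.pi) z = rot a b z :=
  C2_ext rfl (by simp [add_mul, Complex.exp_add, Complex.exp_two_pi_mul_I])

/-- The moment map is proper, since its coordinates sum to `π|z|²`. -/
theorem isCompact_moment_preimage {A : Set Plane} (hA : IsCompact A) :
    IsCompact (moment ⁻¹' A) := by
  have hc : Continuous moment := by unfold moment; fun_prop
  refine Metric.isCompact_of_isClosed_isBounded (hA.isClosed.preimage hc) ?_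
  obtain ⟨B, hB⟩ := hA.bddAbove_image (f := fun x : Plane => x 0 + x 1) (by fun_prop)
  refine (Metric.isBounded_closedBall (x := (0 : C2)) (r := √(B / Real.pi))).subset fun z hz => ?_
  rw [mem_closedBall_zero_iff]
  refine Real.le_sqrt_of_sq_le ?_
  rw [le_div_iff₀ Real.pi_pos, norm_sq_C2]
  have := hB ⟨moment z, hz, rfl⟩
  simp only [moment_zero_apply, moment_one_apply] at this
  linarith

/-! ### Surfaces transverse to the flow -/

theorem toricFlow_neg_cancel (t : ℝ) (z : C2) : toricFlow e (-t) (toricFlow e t z) = z := by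
  rw [← toricFlow_add, neg_add_cancel, toricFlow_zero]

theorem inner_toricGrad_toricField (z : C2) :
    inner ℝ (toricGrad e z) (toricField e z) = (0 : ℝ) := by
  rw [toricField, toricNormal, smul_comm, real_inner_smul_right, inner_toricGrad_I_smul_toricGrad,
    mul_zero]

section Immersion

variable {E : Type*} [NormedAddCommGroup E] [NormedSpace ℝ E]

/-- The map that thickens a surface along the flow and radially. -/
noncomputable def thicken (e : ℝ → ℝ) (j : E → C2) (p : E × ℝ × ℝ) : C2 :=
  p.2.2 • toricFlow e p.2.1 (j p.1)

theorem contDiffAt_thicken (he : ContDiff ℝ ∞ e) (hpos : ∀ s, 0 < e s) {j : E → C2} {u : E}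
    (hj : ContDiffAt ℝ ∞ j u) (h0 : j u ≠ 0) : ContDiffAt ℝ ∞ (thicken e j) (u, 0, 1) := by
  have h1 : ContDiffAt ℝ ∞ (fun p : E × ℝ × ℝ => (p.2.1, j p.1)) (u, 0, 1) :=
    (contDiff_fst.comp contDiff_snd).contDiffAt.prodMk (hj.comp _ contDiffAt_fst)
  have h2 : ContDiffAt ℝ ∞ ((fun q : ℝ × C2 => toricFlow e q.1 q.2) ∘
      fun p : E × ℝ × ℝ => (p.2.1, j p.1)) (u, 0, 1) :=
    ContDiffAt.comp (u, (0 : ℝ), (1 : ℝ)) (contDiffAt_toricFlow he hpos h0 0) h1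
  exact (contDiff_snd.comp contDiff_snd).contDiffAt.smul h2

theorem fderiv_thicken (he : ContDiff ℝ ∞ e) (hpos : ∀ s, 0 < e s) {j : E → C2} {u : E}
    (hj : ContDiffAt ℝ ∞ j u) (h0 : j u ≠ 0) (v : E) (τ ρ : ℝ) :
    fderiv ℝ (thicken e j) (u, 0, 1) (v, τ, ρ) =
      fderiv ℝ j u v + τ • toricField e (j u) + ρ • j u := by
  have hd : HasFDerivAt (thicken e j) _ (u, (0 : ℝ), (1 : ℝ)) :=
    ((contDiffAt_thicken he hpos hj h0).differentiableAt (by simp)).hasFDerivAt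
  have h1 : fderiv ℝ (thicken e j) (u, 0, 1) (v, 0, 0) = fderiv ℝ j u v := by
    have hl : HasFDerivAt (fun w : E => (w, (0 : ℝ), (1 : ℝ)))
        ((ContinuousLinearMap.id ℝ E).prod 0) u :=
      (hasFDerivAt_id u).prodMk (hasFDerivAt_const ((0 : ℝ), (1 : ℝ)) u)
    have hc := HasFDerivAt.comp u hd hl
    have hj' : HasFDerivAt j (fderiv ℝ j u) u := (hj.differentiableAt (by simp)).hasFDerivAt
    have heq : thicken e j ∘ (fun w => (w, (0 : ℝ), (1 : ℝ))) = j := by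
      funext w; simp [thicken, toricFlow_zero]
    have := (heq ▸ hc : HasFDerivAt j _ u).unique hj'
    rw [← this]
    rfl
  have h2 : fderiv ℝ (thicken e j) (u, 0, 1) (0, τ, 0) = τ • toricField e (j u) := by
    have hl : HasDerivAt (fun t : ℝ => (u, t, (1 : ℝ))) ((0 : E), (1 : ℝ), (0 : ℝ)) 0 :=
      (hasDerivAt_const (0 : ℝ) u).prodMk ((hasDerivAt_id (0 : ℝ)).prodMk (hasDerivAt_const _ _))
    have hc := hd.comp_hasDerivAt (0 : ℝ) hl
    have heq : thicken e j ∘ (fun t : ℝ => (u, t, (1 : ℝ))) = fun t => toricFlow e t (j u) := by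
      funext t; simp [thicken]
    rw [heq] at hc
    have hf := hasDerivAt_toricFlow (e := e) (j u) 0
    rw [toricFlow_zero] at hf
    rw [← hc.unique hf, ← map_smul]
    simp
  have h3 : fderiv ℝ (thicken e j) (u, 0, 1) (0, 0, ρ) = ρ • j u := by
    have hl : HasDerivAt (fun r : ℝ => (u, (0 : ℝ), r)) ((0 : E), (0 : ℝ), (1 : ℝ)) 1 :=
      (hasDerivAt_const (1 : ℝ) u).prodMk ((hasDerivAt_const (1 : ℝ) (0 : ℝ)).prodMk
        (hasDerivAt_id (1 : ℝ)))
    have hc := hd.comp_hasDerivAt (1 : ℝ) hl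
    have heq : thicken e j ∘ (fun r : ℝ => (u, (0 : ℝ), r)) = fun r => r • j u := by
      funext t; simp [thicken, toricFlow_zero]
    rw [heq] at hc
    have hf : HasDerivAt (fun r : ℝ => r • j u) ((1 : ℝ) • j u) 1 :=
      (hasDerivAt_id (1 : ℝ)).smul_const (j u)
    rw [one_smul] at hf
    rw [← hc.unique hf, ← map_smul]
    simp
  rw [← h1, ← h2, ← h3, ← map_add, ← map_add]
  simp

/-- Pairing with the gradient kills the radial component, transversality the flow component, and the
immersion property the rest. The radial parameter makes the source four-dimensional, so the inverse
function theorem applies in `ℂ²` itself. -/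
theorem injective_fderiv_thicken (he : ContDiff ℝ ∞ e) (hpos : ∀ s, 0 < e s) {j : E → C2} {u : E}
    (hj : ContDiffAt ℝ ∞ j u) (hM : ∀ u, j u ∈ toricBoundary (profileCurve e))
    (hinj : Function.Injective (fderiv ℝ j u)) (htr : ∀ v, fderiv ℝ j u v ≠ toricField e (j u)) :
    Function.Injective (fderiv ℝ (thicken e j) (u, 0, 1)) := by
  have h0 := ne_zero_of_mem hpos (hM u)
  have hQ : ∀ v, inner ℝ (toricGrad e (j u)) (fderiv ℝ j u v) = (0 : ℝ) := by
    intro v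
    have h1 := (hasFDerivAt_toricGauge he h0).comp u
      (hj.differentiableAt (by simp)).hasFDerivAt
    have heq : toricGauge e ∘ j = fun _ => 1 := funext fun u => (mem_toricBoundary hpos).1 (hM u)
    rw [heq] at h1
    exact congrArg (fun L : E →L[ℝ] ℝ => L v) (h1.unique (hasFDerivAt_const (1 : ℝ) u))
  refine (injective_iff_map_eq_zero _).2 ?_
  rintro ⟨v, τ, ρ⟩ h
  rw [fderiv_thicken he hpos hj h0] at h
  have hρ : ρ = 0 := by
    have h1 := congrArg (fun w => (inner ℝ (toricGrad e (j u)) w : ℝ)) h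
    simp only [inner_add_right, hQ, real_inner_smul_right, inner_toricGrad_toricField,
      inner_toricGrad_self h0, (mem_toricBoundary hpos).1 (hM u), inner_zero_right] at h1
    linarith
  subst hρ
  rw [zero_smul, add_zero] at h
  have hτ : τ = 0 := by
    by_contra hτ
    refine htr (-τ⁻¹ • v) ?_
    rw [map_smul, eq_neg_of_add_eq_zero_left h, smul_neg, neg_smul, neg_neg, smul_smul,
      inv_mul_cancel₀ hτ, one_smul]
  subst hτ
  rw [zero_smul, add_zero] at h
  have hv : v = 0 := hinj (by rw [h, map_zero])
  rw [hv]
  rfl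

/-- Near a point of a surface transverse to the flow, every orbit crosses the surface at a time
that depends continuously on the orbit. -/
theorem exists_crossing_time (he : ContDiff ℝ ∞ e) (hpos : ∀ s, 0 < e s)
    {j : EuclideanSpace ℝ (Fin 2) → C2} {u : EuclideanSpace ℝ (Fin 2)}
    (hj : ContDiffAt ℝ ∞ j u) (hM : ∀ u, j u ∈ toricBoundary (profileCurve e))
    (hinj : Function.Injective (fderiv ℝ j u)) (htr : ∀ v, fderiv ℝ j u v ≠ toricField e (j u)) :
    ∃ U ∈ 𝓝 (j u), ∃ W ∈ 𝓝 u, ∃ ε > 0, ∃ F : C2 → ℝ, ContinuousOn F U ∧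
      ∀ p ∈ U, p ∈ toricBoundary (profileCurve e) → (∃ w, toricFlow e (F p) p = j w) ∧
        ∀ t, |t| < ε → ∀ w ∈ W, toricFlow e t p = j w → t = F p := by
  have h0 := ne_zero_of_mem hpos (hM u)
  have hcd := contDiffAt_thicken he hpos hj h0
  have hLinj := injective_fderiv_thicken he hpos hj hM hinj htr
  let L : (EuclideanSpace ℝ (Fin 2) × ℝ × ℝ) ≃L[ℝ] C2 :=
    (LinearMap.linearEquivOfInjective
      (fderiv ℝ (thicken e j) (u, 0, 1) : EuclideanSpace ℝ (Fin 2) × ℝ × ℝ →ₗ[ℝ] C2) hLinj (by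
        have : Module.finrank ℝ C2 = 4 := by
          rw [← Module.finrank_mul_finrank ℝ ℂ C2]; simp
        rw [this]; simp)).toContinuousLinearEquiv
  have hd : HasFDerivAt (thicken e j)
      (L : EuclideanSpace ℝ (Fin 2) × ℝ × ℝ →L[ℝ] C2) (u, (0 : ℝ), (1 : ℝ)) :=
    (hcd.differentiableAt (by simp)).hasFDerivAt
  let Θ := hcd.toOpenPartialHomeomorph (thicken e j) hd (by simp)
  have hΘ : ∀ p, Θ p = thicken e j p := fun _ => rfl
  have hsrc : (u, (0 : ℝ), (1 : ℝ)) ∈ Θ.source :=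
    hcd.mem_toOpenPartialHomeomorph_source hd (by simp)
  have hval : Θ (u, (0 : ℝ), (1 : ℝ)) = j u := by simp [hΘ, thicken, toricFlow_zero]
  have hOpen : IsOpen (Θ.target ∩ Θ.symm ⁻¹' {p | 0 < p.2.2}) :=
    Θ.symm.isOpen_inter_preimage (isOpen_lt continuous_const (by fun_prop))
  have hN := Θ.open_source.mem_nhds hsrc
  rw [nhds_prod_eq, nhds_prod_eq] at hN
  obtain ⟨W, hW, T, hT, hWT⟩ := Filter.mem_prod_iff.1 hN
  obtain ⟨T₁, hT₁, T₂, hT₂, hT₁₂⟩ := Filter.mem_prod_iff.1 hT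
  obtain ⟨ε, hε, hεT⟩ := Metric.mem_nhds_iff.1 hT₁
  -- A point reached from the surface by flowing for time `τ` meets it after time `-τ`; hence the
  -- sign.
  refine ⟨_, hOpen.mem_nhds ⟨?_, ?_⟩, W, hW, ε, hε, fun p => -(Θ.symm p).2.1, ?_, ?_⟩
  · rw [← hval]; exact Θ.map_source hsrc
  · rw [Set.mem_preimage, ← hval, Θ.left_inv hsrc]
    exact one_pos (α := ℝ)
  · have : ContinuousOn Θ.symm (Θ.target ∩ Θ.symm ⁻¹' {p | 0 < p.2.2}) :=
      Θ.continuousOn_symm.mono Set.inter_subset_left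
    exact (continuous_fst.comp_continuousOn (continuous_snd.comp_continuousOn this)).neg
  · rintro p ⟨hp, hr⟩ hpM
    constructor
    · refine ⟨(Θ.symm p).1, ?_⟩
      have h1 : (Θ.symm p).2.2 • toricFlow e (Θ.symm p).2.1 (j (Θ.symm p).1) = p := by
        have := Θ.right_inv hp
        rwa [hΘ] at this
      -- The gauge is `1` at both points and scales by the square of the radial parameter, which is
      -- positive on the chosen neighbourhood.
      have h2 : (Θ.symm p).2.2 = 1 := by
        have h3 := (mem_toricBoundary hpos).1 hpM
        have h4 := (mem_toricBoundary hpos).1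
          ((isFlowOn_toricFlow hpos).mem _ (hM (Θ.symm p).1) (Θ.symm p).2.1)
        rw [← h1, toricGauge_smul, h4, mul_one] at h3
        have hr' : 0 < (Θ.symm p).2.2 := hr
        nlinarith
      rw [h2, one_smul] at h1
      nth_rewrite 2 [← h1]
      exact toricFlow_neg_cancel _ _
    · intro t ht w hw htw
      have hmem : (w, -t, (1 : ℝ)) ∈ Θ.source := by
        refine hWT ⟨hw, hT₁₂ ⟨hεT ?_, mem_of_mem_nhds hT₂⟩⟩
        simpa using ht
      have h1 : Θ (w, -t, (1 : ℝ)) = p := by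
        rw [hΘ, thicken]
        simp only [one_smul, ← htw]
        exact toricFlow_neg_cancel t p
      have h2 := Θ.left_inv hmem
      rw [h1] at h2
      simp [h2]

end Immersion

variable {S : Type*} [TopologicalSpace S] [T2Space S] [CompactSpace S]
  [ChartedSpace (EuclideanHalfSpace 2) S] [IsManifold (𝓡∂ 2) ∞ S] {ι : S → C2}

/-- Near an interior point of the surface, the inverse function theorem in a chart gives the
crossing time. Short orbit segments stay off the compact boundary image, and the embedding property
excludes other sheets. -/
theorem exists_crossing_time_of_isBirkhoffSection (he : ContDiff ℝ ∞ e) (hpos : ∀ s, 0 < e s)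
    (h : IsBirkhoffSection (toricBoundary (profileCurve e)) (toricField e) (toricFlow e) ι)
    {q : C2} (hq : q ∈ toricBoundary (profileCurve e)) (hqb : q ∉ ι '' (𝓡∂ 2).boundary S) :
    ∃ ε > 0, ∃ U ∈ 𝓝 q, ∃ F : C2 → ℝ, ContinuousOn F U ∧
      ∀ p ∈ U, p ∈ toricBoundary (profileCurve e) → ∀ t, |t| < ε →
        (toricFlow e t p ∈ Set.range ι ↔ t = F p) := by
  have hιc : Continuous ι := h.smooth.continuous
  have hflow : Filter.Tendsto (fun p : ℝ × C2 => toricFlow e p.1 p.2) (𝓝 0 ×ˢ 𝓝 q) (𝓝 q) := by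
    have := (contDiffAt_toricFlow he hpos (ne_zero_of_mem hpos hq) 0).continuousAt.tendsto
    rwa [nhds_prod_eq, toricFlow_zero] at this
  have hshort : ∀ O ∈ 𝓝 q, ∃ ε > 0, ∃ U ∈ 𝓝 q, ∀ t, |t| < ε → ∀ p ∈ U, toricFlow e t p ∈ O := by
    intro O hO
    obtain ⟨T, hT, U, hU, hTU⟩ := Filter.mem_prod_iff.1 (hflow hO)
    obtain ⟨ε, hε, hεT⟩ := Metric.mem_nhds_iff.1 hT
    exact ⟨ε, hε, U, hU, fun t ht p hp => hTU (Set.mk_mem_prod (hεT (by simpa using ht)) hp)⟩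
  by_cases hr : q ∈ Set.range ι
  · obtain ⟨x, rfl⟩ := hr
    have hx : x ∉ (𝓡∂ 2).boundary S := fun hx => hqb ⟨x, hx, rfl⟩
    have hxi : (𝓡∂ 2).IsInteriorPoint x := by
      rw [ModelWithCorners.isInteriorPoint_iff_not_isBoundaryPoint]; exact hx
    have hnhds : Set.range (𝓡∂ 2) ∈ 𝓝 (extChartAt (𝓡∂ 2) x x) := range_mem_nhds_isInteriorPoint hxi
    let j : EuclideanSpace ℝ (Fin 2) → C2 := ι ∘ (extChartAt (𝓡∂ 2) x).symm
    have hju : j (extChartAt (𝓡∂ 2) x x) = ι x :=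
      congrArg ι ((extChartAt (𝓡∂ 2) x).left_inv (mem_extChartAt_source x))
    have hjd : ContDiffAt ℝ ∞ j (extChartAt (𝓡∂ 2) x x) :=
      ((contMDiffAt_iff.1 (h.smooth x)).2).contDiffAt hnhds
    obtain ⟨L, hL, hmf⟩ : ∃ L : EuclideanSpace ℝ (Fin 2) →L[ℝ] C2,
        (∀ v, L v = mfderiv (𝓡∂ 2) 𝓘(ℝ, C2) ι x v) ∧
          HasFDerivAt j L (extChartAt (𝓡∂ 2) x x) :=
      ⟨mfderiv (𝓡∂ 2) 𝓘(ℝ, C2) ι x, fun _ => rfl,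
        (((h.smooth x).mdifferentiableAt (by simp)).hasMFDerivAt.2).hasFDerivAt hnhds⟩
    have hinj : Function.Injective (fderiv ℝ j (extChartAt (𝓡∂ 2) x x)) := by
      rw [hmf.fderiv]
      exact fun v w hvw => h.immersion x (by rw [← hL, ← hL, hvw])
    have htr : ∀ v, fderiv ℝ j (extChartAt (𝓡∂ 2) x x) v ≠
        toricField e (j (extChartAt (𝓡∂ 2) x x)) := by
      rw [hmf.fderiv, hju]
      exact fun v hv => h.transverse x hx v ((hL v).symm.trans hv)
    obtain ⟨U, hU, W, hW, ε, hε, F, hF, hcross⟩ :=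
      exists_crossing_time he hpos hjd (fun u => h.mem _) hinj htr
    rw [hju] at hU
    have hV : (extChartAt (𝓡∂ 2) x).source ∩ extChartAt (𝓡∂ 2) x ⁻¹' W ∈ 𝓝 x :=
      Filter.inter_mem (extChartAt_source_mem_nhds x) ((continuousAt_extChartAt x) hW)
    have hV' : Subtype.val ⁻¹' ((extChartAt (𝓡∂ 2) x).source ∩ extChartAt (𝓡∂ 2) x ⁻¹' W) ∈
        𝓝 (⟨x, hx⟩ : {x : S // x ∉ (𝓡∂ 2).boundary S}) :=
      continuous_subtype_val.continuousAt hV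
    -- Interior points of the surface with image close to that of `x` lie in the chart window.
    rw [h.embedding.nhds_eq_comap] at hV'
    obtain ⟨O, hO, hOV⟩ := hV'
    have hb : IsClosed (ι '' (𝓡∂ 2).boundary S) :=
      ((ModelWithCorners.isClosed_boundary (n := ∞) (by simp)).isCompact.image hιc).isClosed
    obtain ⟨ε', hε', U', hU', hsh⟩ := hshort _ (Filter.inter_mem hO (hb.isOpen_compl.mem_nhds hqb))
    refine ⟨min ε ε', lt_min hε hε', U ∩ U', Filter.inter_mem hU hU', F,
      hF.mono Set.inter_subset_left, fun p hp hpM t ht => ⟨?_, ?_⟩⟩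
    · rintro ⟨y, hy⟩
      obtain ⟨hyO, hyb⟩ := hsh t (ht.trans_le (min_le_right _ _)) p hp.2
      rw [← hy] at hyO hyb
      have hyb' : y ∉ (𝓡∂ 2).boundary S := fun hh => hyb ⟨y, hh, rfl⟩
      obtain ⟨hys, hyW⟩ := @hOV ⟨y, hyb'⟩ hyO
      refine (hcross p hp.1 hpM).2 t (ht.trans_le (min_le_left _ _)) _ hyW ?_
      rw [← hy]
      simp only [j, Function.comp]
      rw [(extChartAt (𝓡∂ 2) x).left_inv hys]
    · rintro rfl
      obtain ⟨w, hw⟩ := (hcross p hp.1 hpM).1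
      exact ⟨_, hw.symm⟩
  · obtain ⟨ε, hε, U, hU, hsh⟩ := hshort (Set.range ι)ᶜ
      ((isCompact_range hιc).isClosed.isOpen_compl.mem_nhds hr)
    -- The constant time `ε`, just outside the window, encodes that there is no crossing.
    refine ⟨ε, hε, U, hU, fun _ => ε, continuousOn_const, fun p hp _ t ht =>
      ⟨fun hh => (hsh t ht p hp hh).elim, ?_⟩⟩
    rintro rfl
    exact absurd ht (not_lt.2 (le_abs_self t))

/-! ### Boundary orbits over a semicircle -/

theorem arcPt_projIcc_mem (hκ : 0 < κ) (s : ℝ) :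
    arcPt σ κ (Set.projIcc (-(Real.pi / 2)) (Real.pi / 2) (by linarith [Real.pi_pos]) s) ∈
      outerSemicircle (simplexPt σ) (κ * ‖simplexPt σ‖) := by
  rw [outerSemicircle_eq_image σ hκ]
  exact ⟨_, Subtype.coe_prop _, rfl⟩

theorem mem_toricBoundary_of_moment_mem (hpos : ∀ s, 0 < e s) (hκ : 0 < κ)
    (h : ∀ φ ∈ Set.Icc (-(Real.pi / 2)) (Real.pi / 2), gauge e (arcPt σ κ φ) = 1) {z : C2}
    (hz : moment z ∈ outerSemicircle (simplexPt σ) (κ * ‖simplexPt σ‖)) :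
    z ∈ toricBoundary (profileCurve e) := by
  rw [outerSemicircle_eq_image σ hκ] at hz
  obtain ⟨φ, hφ, hz⟩ := hz
  rw [mem_toricBoundary hpos, toricGauge, ← hz, h φ hφ]

/-- The restriction of the flow to the tori over a set. -/
noncomputable def toricFlowOn (he : ContDiff ℝ ∞ e) (hpos : ∀ s, 0 < e s) (A : Set Plane)
    (hA : ∀ z, moment z ∈ A → z ≠ 0) : Flow ℝ {z : C2 // moment z ∈ A} where
  toFun t z := ⟨toricFlow e t z, by rw [moment_toricFlow]; exact z.2⟩
  cont' := by
    refine Continuous.subtype_mk ?_ _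
    refine continuous_iff_continuousAt.2 fun p => ?_
    have h1 : ContinuousAt (fun p : ℝ × {z : C2 // moment z ∈ A} => (p.1, (p.2 : C2))) p := by
      fun_prop
    exact ContinuousAt.comp (f := fun p : ℝ × {z : C2 // moment z ∈ A} => (p.1, (p.2 : C2)))
      (g := fun q : ℝ × C2 => toricFlow e q.1 q.2)
      (contDiffAt_toricFlow he hpos (hA _ p.2.2) p.1).continuousAt h1
  map_add' s t z := Subtype.ext (toricFlow_add s t z.1)
  map_zero' z := Subtype.ext (toricFlow_zero z.1)

/-- An orbit stays over one point of the plane, so orbits over disjoint sets are distinct. -/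
theorem natCast_le_encard_boundaryOrbits {S : Type*} [TopologicalSpace S]
    [ChartedSpace (EuclideanHalfSpace 2) S] {ι : S → C2} {k : ℕ} {A : Fin k → Set Plane}
    (hA : Pairwise fun i j => Disjoint (A i) (A j))
    (hb : ∀ i, ∃ x ∈ (𝓡∂ 2).boundary S, moment (ι x) ∈ A i) :
    (k : ℕ∞) ≤ (boundaryOrbits (toricFlow e) ι).encard := by
  choose x hx hxA using hb
  have hinj : Function.Injective fun i => orbit (toricFlow e) (ι (x i)) := by
    intro i j hij
    by_contra hne
    have h1 : ι (x i) ∈ orbit (toricFlow e) (ι (x j)) := by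
      have h2 : ι (x i) ∈ orbit (toricFlow e) (ι (x i)) := ⟨0, toricFlow_zero _⟩
      rwa [show orbit (toricFlow e) (ι (x i)) = orbit (toricFlow e) (ι (x j)) from hij] at h2
    obtain ⟨t, ht⟩ := h1
    refine Set.disjoint_left.1 (hA hne) (hxA i) ?_
    rw [← ht]
    simp only [moment_toricFlow]
    exact hxA j
  have hsub : Set.range (fun i => orbit (toricFlow e) (ι (x i))) ⊆
      boundaryOrbits (toricFlow e) ι := by
    rintro _ ⟨i, rfl⟩
    exact ⟨x i, hx i, rfl⟩
  refine le_trans (le_of_eq ?_) (Set.encard_le_encard hsub)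
  rw [← Set.image_univ, hinj.encard_image, Set.encard_univ]
  simp

/-- A Birkhoff section has a boundary orbit over every semicircle in the profile curve. -/
theorem exists_boundary_over_semicircle (he : ContDiff ℝ ∞ e) (hpos : ∀ s, 0 < e s)
    (hσ : σ ∈ Set.Ioo (0 : ℝ) 1) (hκ : 0 < κ) (hκ' : κ ≤ 1 / 4)
    (hq : ∀ φ, arcPt σ κ φ ∈ quadrant)
    (h : ∀ φ ∈ Set.Icc (-(Real.pi / 2)) (Real.pi / 2), gauge e (arcPt σ κ φ) = 1)
    (hι : IsBirkhoffSection (toricBoundary (profileCurve e)) (toricField e) (toricFlow e) ι) :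
    ∃ x ∈ (𝓡∂ 2).boundary S,
      moment (ι x) ∈ outerSemicircle (simplexPt σ) (κ * ‖simplexPt σ‖) := by
  by_contra! hno
  set A := outerSemicircle (simplexPt σ) (κ * ‖simplexPt σ‖) with hAdef
  have hAM : ∀ z, moment z ∈ A → z ∈ toricBoundary (profileCurve e) := fun z hz =>
    mem_toricBoundary_of_moment_mem hpos hκ h hz
  have hAc : IsCompact A := by
    rw [hAdef, outerSemicircle_eq_image σ hκ]
    exact isCompact_Icc.image (continuous_arcPt σ κ)
  have : CompactSpace {z : C2 // moment z ∈ A} :=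
    isCompact_iff_compactSpace.1 (isCompact_moment_preimage hAc)
  let Φ := toricFlowOn he hpos A fun z hz => ne_zero_of_mem hpos (hAM z hz)
  have hΦ : ∀ t z, ((Φ t z : {z : C2 // moment z ∈ A}) : C2) = toricFlow e t z := fun _ _ => rfl
  have hP : ∀ p, moment (torusFamily σ κ p) ∈ A := by
    intro p
    rw [torusFamily, moment_rot, moment_basePt (hq _)]
    exact arcPt_projIcc_mem hκ _
  obtain ⟨p, hp⟩ := not_exists_section_of_linear_flow Φ (Subtype.val ⁻¹' Set.range ι) (fun q => by
      obtain ⟨ε, hε, U, hU, F, hF, hcross⟩ := exists_crossing_time_of_isBirkhoffSection he hpos hι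
        (hAM _ q.2) (by rintro ⟨x, hx, hxq⟩; exact hno x hx (by rw [hxq]; exact q.2))
      exact ⟨ε, hε, Subtype.val ⁻¹' U, continuous_subtype_val.continuousAt hU,
        fun z => F z, hF.comp continuous_subtype_val.continuousOn fun _ hz => hz,
        fun z hz t ht => hcross z hz (hAM _ z.2) t ht⟩)
    -- Clamping the angle parametrizes the family by all of `ℝ³`, where circle-valued maps lift.
    (P := fun p => ⟨torusFamily σ κ p, hP p⟩) ((continuous_torusFamily σ κ).subtype_mk _)
    (fun x y s => Subtype.ext (rot_add_two_pi_left _ _ _))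
    (fun x y s => Subtype.ext (rot_add_two_pi_right _ _ _))
    (a := fun s => speed₀ e (torusFamily σ κ (0, 0, s)))
    (b := fun s => speed₁ e (torusFamily σ κ (0, 0, s)))
    (fun m n => by
      -- The class `(m, n)` annihilates the direction `(-n, m)`, which occurs over the arc; for the
      -- zero class any torus will do.
      by_cases hmn : (0 : ℝ) < (-n : ℝ) ^ 2 + (m : ℝ) ^ 2
      · obtain ⟨φ, hφ, l, -, h0, h1⟩ := exists_arc_direction he hpos hσ hκ hκ' h hmn
        refine ⟨φ, ?_⟩
        have hz : zratio (torusFamily σ κ (0, 0, φ)) =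
            arcPt σ κ φ 0 / (arcPt σ κ φ 0 + arcPt σ κ φ 1) := by
          rw [← moment_ratio, torusFamily, moment_rot, moment_basePt (hq _),
            Set.projIcc_of_mem _ hφ]
        rw [speed₀, speed₁, hz, h0, h1]
        ring
      · have hm : (m : ℝ) = 0 := by nlinarith [sq_nonneg (m : ℝ), sq_nonneg (n : ℝ)]
        have hn : (n : ℝ) = 0 := by nlinarith [sq_nonneg (m : ℝ), sq_nonneg (n : ℝ)]
        exact ⟨0, by rw [hm, hn]; ring⟩)
    (fun t s => Subtype.ext (by
      rw [hΦ]
      simp only [torusFamily, rot_zero]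
      rfl))
  obtain ⟨t, ht, hr⟩ := (hι.returns p (hAM _ p.2)).2
  exact hp t ht hr

/-! ### Placing the semicircles and the final theorem -/

theorem outerSemicircle_subset_profileCurve (hpos : ∀ s, 0 < e s) (hκ : 0 < κ)
    (hq : ∀ φ, 0 < arcPt σ κ φ 0 ∧ 0 < arcPt σ κ φ 1)
    (h : ∀ φ ∈ Set.Icc (-(Real.pi / 2)) (Real.pi / 2), gauge e (arcPt σ κ φ) = 1) :
    outerSemicircle (simplexPt σ) (κ * ‖simplexPt σ‖) ⊆ profileCurve e '' Set.Ioo 0 1 := by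
  rw [outerSemicircle_eq_image σ hκ]
  rintro _ ⟨φ, hφ, rfl⟩
  obtain ⟨h0, h1⟩ := hq φ
  refine ⟨arcPt σ κ φ 0 / (arcPt σ κ φ 0 + arcPt σ κ φ 1), ⟨by positivity, ?_⟩, ?_⟩
  · rw [div_lt_one (by positivity)]
    linarith
  · have := gauge_smul_profileCurve hpos (x := arcPt σ κ φ) ⟨h0.le, h1.le⟩
    rwa [h φ hφ, one_smul] at this

theorem disjoint_outerSemicircle {τ : ℝ} (hσ : σ ∈ Set.Ioo (0 : ℝ) 1) (hτ : τ ∈ Set.Ioo (0 : ℝ) 1)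
    (hκ : 0 < κ) (hκ' : κ ≤ 1 / 4) (hd : 4 * κ < |σ - τ|) :
    Disjoint (outerSemicircle (simplexPt σ) (κ * ‖simplexPt σ‖))
      (outerSemicircle (simplexPt τ) (κ * ‖simplexPt τ‖)) := by
  rw [outerSemicircle_eq_image σ hκ, outerSemicircle_eq_image τ hκ, Set.disjoint_left]
  rintro _ ⟨φ, -, rfl⟩ ⟨ψ, -, hψ⟩
  have h1 := abs_arcPt_ratio_sub_le (φ := φ) hσ hκ hκ'
  have h2 := abs_arcPt_ratio_sub_le (φ := ψ) hτ hκ hκ'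
  rw [hψ] at h2
  have h3 := abs_sub_le σ (arcPt σ κ φ 0 / (arcPt σ κ φ 0 + arcPt σ κ φ 1)) τ
  rw [abs_sub_comm σ (_ / _)] at h3
  linarith

theorem one_div_le_abs_sub {k : ℕ} {i j : Fin k} (h : i ≠ j) :
    1 / ((k : ℝ) + 1) ≤ |((i : ℕ) + 1 : ℝ) / (k + 1) - ((j : ℕ) + 1 : ℝ) / (k + 1)| := by
  have h1 : (1 : ℝ) ≤ |((i : ℕ) : ℝ) - ((j : ℕ) : ℝ)| := by
    have h2 : ((i : ℕ) : ℤ) - ((j : ℕ) : ℤ) ≠ 0 :=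
      sub_ne_zero.2 fun hh => h (Fin.ext (by exact_mod_cast hh))
    exact_mod_cast Int.one_le_abs h2
  rw [← sub_div, abs_div, abs_of_pos (show (0 : ℝ) < k + 1 by positivity), add_sub_add_right_eq_sub]
  gcongr

end ToricBirkhoff

open ToricBirkhoff in
theorem theorem5p9 (k : ℕ) (hk : 0 < k) :
    ∃ (Ω : Set Plane) (f : ℝ → Plane) (X : C2 → C2) (φ : ℝ → C2 → C2),
      IsBoundedByCurve Ω f ∧
      IsStarShaped (toricBoundary f) ∧
      IsStandardField (toricDomain Ω) (toricBoundary f) X ∧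
      IsFlowOn (toricBoundary f) X φ ∧
      IsEquivalentToTightReebFlow (toricBoundary f) X ∧
      (∃ (c : Fin k → Plane) (ρ : Fin k → ℝ),
        (∀ i, c i ≠ 0 ∧ 0 < ρ i ∧ outerSemicircle (c i) (ρ i) ⊆ f '' Set.Ioo 0 1 ∧
          SweepsAllDirections X (outerSemicircle (c i) (ρ i))) ∧
        Pairwise fun i j => Disjoint (outerSemicircle (c i) (ρ i)) (outerSemicircle (c j) (ρ j))) ∧
      ∀ (S : Type*) [TopologicalSpace S] [T2Space S] [CompactSpace S]
        [ChartedSpace (EuclideanHalfSpace 2) S] [IsManifold (𝓡∂ 2) ∞ S] (ι : S → C2),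
        IsBirkhoffSection (toricBoundary f) X φ ι →
          (k : ℕ∞) ≤ (boundaryOrbits φ ι).encard := by
  have hk1 : (0 : ℝ) < k + 1 := by positivity
  have hinv : 0 < 1 / ((k : ℝ) + 1) := by positivity
  have hinv' : 1 / ((k : ℝ) + 1) ≤ 1 := by
    rw [div_le_one hk1]
    linarith [(Nat.cast_nonneg k : (0 : ℝ) ≤ k)]
  -- The centres `(i + 1) / (k + 1)` are at least `8 * κ` from each other and from `0` and `1`,
  -- while disjointness needs more than `4 * κ` and positivity more than `2 * κ`.
  set κ : ℝ := 1 / (k + 1) / 8 with hκdef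
  have hκ : 0 < κ := by positivity
  have hκ' : κ ≤ 1 / 4 := by linarith
  let σ : Fin k → ℝ := fun i => ((i : ℕ) + 1 : ℝ) / (k + 1)
  have hσ₀ : ∀ i, 2 * κ < σ i := by
    intro i
    have : 1 / ((k : ℝ) + 1) ≤ σ i := by
      simp only [σ]
      gcongr
      linarith [(Nat.cast_nonneg (i : ℕ) : (0 : ℝ) ≤ (i : ℕ))]
    linarith
  have hσ₁ : ∀ i, 2 * κ < 1 - σ i := by
    intro i
    have : 1 / ((k : ℝ) + 1) ≤ 1 - σ i := by
      have hi : ((i : ℕ) : ℝ) + 1 ≤ k := by exact_mod_cast i.2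
      simp only [σ]
      rw [one_sub_div hk1.ne']
      gcongr
      linarith
    linarith
  have hσ : ∀ i, σ i ∈ Set.Ioo (0 : ℝ) 1 := fun i =>
    ⟨by linarith [hσ₀ i], by linarith [hσ₁ i]⟩
  have hdisj : Pairwise fun i j => 4 * κ < |σ i - σ j| := fun i j hij => by
    have := one_div_le_abs_sub hij
    exact lt_of_lt_of_le (by linarith) this
  obtain ⟨e, he, hpos, harc⟩ := exists_profile hσ hκ hκ' hdisj
  have hpt : ∀ i φ, 0 < arcPt (σ i) κ φ 0 ∧ 0 < arcPt (σ i) κ φ 1 := fun i φ =>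
    arcPt_pos (hσ i) hκ hκ' (hσ₀ i) (hσ₁ i)
  have hquad : ∀ i φ, arcPt (σ i) κ φ ∈ quadrant := fun i φ => ⟨(hpt i φ).1.le, (hpt i φ).2.le⟩
  have hA : Pairwise fun i j =>
      Disjoint (outerSemicircle (simplexPt (σ i)) (κ * ‖simplexPt (σ i)‖))
        (outerSemicircle (simplexPt (σ j)) (κ * ‖simplexPt (σ j)‖)) := fun i j hij =>
    disjoint_outerSemicircle (hσ i) (hσ j) hκ hκ' (hdisj hij)
  refine ⟨profileRegion e, profileCurve e, toricField e, toricFlow e,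
    isBoundedByCurve_profile he hpos, isStarShaped_profile he hpos,
    isStandardField_toricField he hpos, isFlowOn_toricFlow hpos,
    isEquivalentToTightReebFlow_profile he hpos,
    ⟨fun i => simplexPt (σ i), fun i => κ * ‖simplexPt (σ i)‖, fun i =>
      ⟨simplexPt_ne_zero _, mul_pos hκ (norm_pos_iff.2 (simplexPt_ne_zero _)),
        outerSemicircle_subset_profileCurve hpos hκ (hpt i) (harc i),
        sweepsAllDirections_toricField he hpos (hσ i) hκ hκ' (hquad i) (harc i)⟩, hA⟩, ?_⟩
  intro S _ _ _ _ _ ι hι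
  exact natCast_le_encard_boundaryOrbits hA fun i =>
    exists_boundary_over_semicircle he hpos (hσ i) hκ hκ' (hquad i) (harc i) hι
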